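/- Let $\omega\subset\mathbb R^N$ be a nonempty bounded open set with Lipschitz boundary, $0<\alpha<\beta$, and let $A_\omega=[a_{kl}]$ be a measurable real matrix function on $\omega$ which for a.e. $y\in\omega$ is symmetric and satisfies $(A_\omega(y)\xi,\xi)\ge\alpha|\xi|^2$, $|A_\omega(y)\xi|\le\beta|\xi|$ for all $\xi\in\mathbb R^N$. Assume that $A_\omega$ is equivalent to a constant positive definite matrix $M=[m_{kl}]$ (the Hashin–Shtrikman homogenized matrix): extending $A_\omega$ by $M$ to $\mathbb R^N\setminus\omega$, for every $\lambda\in\mathbb R^N$ there is $w_\lambda\in H^1_{loc}(\mathbb R^N)$ with $$-\mathrm{div}(A_\omega\nabla w_\lambda)=0\ \text{ in }\mathbb R^N,\qquad w_\lambda(y)=(\lambda,y)\ \text{ in }\mathbb R^N\setminus\omega .$$ Let $H^1_c(\omega)$ be the space of complex-valued $\varphi\in H^1_{loc}(\mathbb R^N)$ that are constant on $\mathbb R^N\setminus\omega$ (the constant depends on $\varphi$), with the norm of $H^1(\omega)$. For $\eta\in\mathbb R^N$ call $\mu$ a Bloch eigenvalue at $\eta$, with eigenvector $0\ne\varphi\in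 H^1_c(\omega)$, if $$\int_\omega a_{kl}\,(\partial_l\varphi+i\eta_l\varphi)\,\overline{(\partial_k\psi+i\eta_k\psi)}\,dy=\mu\int_\omega\varphi\,\overline\psi\,dy\qquad\forall\psi\in H^1_c(\omega)$$ (summation over $k,l$), and let $\lambda_1(\eta)$ be the smallest Bloch eigenvalue at $\eta$. Then there are an open neighborhood $U$ of $0$ in $\mathbb R^N$ and a map $\eta\mapsto\varphi_{\omega,1}(\cdot;\eta)$ into $H^1_c(\omega)$ such that: 1. for every $\eta\in U$ the smallest Bloch eigenvalue $\lambda_1(\eta)$ exists, $\varphi_{\omega,1}(\cdot;\eta)$ is an eigenvector for it with the boundary normalization $\varphi_{\omega,1}(\cdot;\eta)=|\omega|^{-1/2}$ on $\mathbb R^N\setminus\omega$, and every eigenvector for $\lambda_1(\eta)$ is a complex multiple of $\varphi_{\omega,1}(\cdot;\eta)$; 2. $\lambda_1:U\to\mathbb R$ and $\varphi_{\omega,1}:U\to H^1_c(\omega)$ are real-analytic; 3. $\varphi_{\omega,1}(\cdot;0)=|\omega|^{-1/2}$, $\lambda_1(0)=0$ and $D_k\lambda_1(0)=0$ for all $k$;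 4. $D_k\varphi_{\omega,1}(y;0)=i|\omega|^{-1/2}(w_{e_k}(y)-y_k)$ for a.e. $y\in\omega$ and all $k$, for every choice of $w_{e_k}$ as above; 5. $\tfrac12D^2_{kl}\lambda_1(0)=m_{kl}$ for all $k,l=1,\dots,N$. -/

import Mathlib

open MeasureTheory Filter Topology
open scoped ENNReal InnerProductSpace

noncomputable section

namespace HSBloch

/-- The Euclidean space `ℝ^N`. -/
abbrev Euc (N : ℕ) := EuclideanSpace ℝ (Fin N)

/-- The `k`-th vector of the canonical basis of `ℝ^N`. -/
abbrev stdVec {N : ℕ} (k : Fin N) : Euc N := EuclideanSpace.single k (1 : ℝ)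

/-- Lipschitz boundary: near every boundary point, in suitable orthonormal coordinates (one axis
being the unit vector `ν`), the set is the strict epigraph of a Lipschitz function of the
variables orthogonal to `ν`. -/
def HasLipschitzBoundary {N : ℕ} (ω : Set (Euc N)) : Prop :=
  ∀ x ∈ frontier ω, ∃ r : ℝ, 0 < r ∧ ∃ ν : Euc N, ‖ν‖ = 1 ∧
    ∃ (K : NNReal) (γ : (ℝ ∙ ν)ᗮ → ℝ), LipschitzWith K γ ∧
      ∀ y ∈ Metric.ball x r, (y ∈ ω ↔ γ ((ℝ ∙ ν)ᗮ.orthogonalProjectionOnto y) < ⟪ν, y⟫_ℝ)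

/-- Test functions: real-valued, smooth and compactly supported on `ℝ^N`. -/
def IsTestFunction {N : ℕ} (ψ : Euc N → ℝ) : Prop :=
  ContDiff ℝ ((⊤ : ℕ∞) : WithTop ℕ∞) ψ ∧ HasCompactSupport ψ

/-- `u ∈ H¹_loc(ℝ^N)` with weak gradient `G`: both are square integrable on compact sets, and
`∫ u ∂_k ψ = - ∫ G_k ψ` for all test functions `ψ` and all `k`. -/
structure IsH1loc {N : ℕ} {𝕜 : Type*} [RCLike 𝕜] (u : Euc N → 𝕜)
    (G : Euc N → EuclideanSpace 𝕜 (Fin N)) : Prop where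
  memLp : ∀ K : Set (Euc N), IsCompact K → MemLp u 2 (volume.restrict K)
  memLp_grad : ∀ K : Set (Euc N), IsCompact K → MemLp G 2 (volume.restrict K)
  weak : ∀ ψ : Euc N → ℝ, IsTestFunction ψ → ∀ k : Fin N,
    ∫ x, (fderiv ℝ ψ x (stdVec k)) • u x = - ∫ x, ψ x • G x k

/-- The class `𝓜(α, β; ω)` of measurable coefficient matrices that are almost everywhere symmetric
on `ω`, with `(A ξ, ξ) ≥ α |ξ|²` and `|A ξ| ≤ β |ξ|`. -/
structure IsCoefficient {N : ℕ} (α β : ℝ) (ω : Set (Euc N))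
    (A : Euc N → Matrix (Fin N) (Fin N) ℝ) : Prop where
  measurable : ∀ k l : Fin N, AEStronglyMeasurable (fun y => A y k l) (volume.restrict ω)
  symm : ∀ᵐ y ∂volume.restrict ω, ∀ k l : Fin N, A y k l = A y l k
  lower : ∀ᵐ y ∂volume.restrict ω, ∀ ξ : Euc N,
    α * ‖ξ‖ ^ 2 ≤ ⟪(A y).toEuclideanLin ξ, ξ⟫_ℝ
  upper : ∀ᵐ y ∂volume.restrict ω, ∀ ξ : Euc N, ‖(A y).toEuclideanLin ξ‖ ≤ β * ‖ξ‖

open Classical in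
/-- The coefficients `A` on `ω`, extended by the constant matrix `M` to `ℝ^N ∖ ω`. -/
def extendCoeff {N : ℕ} (ω : Set (Euc N)) (A : Euc N → Matrix (Fin N) (Fin N) ℝ)
    (M : Matrix (Fin N) (Fin N) ℝ) : Euc N → Matrix (Fin N) (Fin N) ℝ :=
  fun y => if y ∈ ω then A y else M

/-- `w` is a function `w_ξ`: it lies in `H¹_loc(ℝ^N)`, satisfies `- div (A ∇ w) = 0` in the sense
of distributions on `ℝ^N` (with `A` extended by `M`), and `w(y) = (ξ, y)` on `ℝ^N ∖ ω`. -/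
def IsCellSolution {N : ℕ} (ω : Set (Euc N)) (A : Euc N → Matrix (Fin N) (Fin N) ℝ)
    (M : Matrix (Fin N) (Fin N) ℝ) (ξ : Euc N) (w : Euc N → ℝ) : Prop :=
  ∃ G : Euc N → Euc N, IsH1loc w G ∧
    (∀ ψ : Euc N → ℝ, IsTestFunction ψ →
      ∫ y, ∑ k, ∑ l, extendCoeff ω A M y k l * G y l * fderiv ℝ ψ y (stdVec k) = 0) ∧
    ∀ᵐ y ∂volume.restrict ωᶜ, w y = ⟪ξ, y⟫_ℝ

/-- `A` is equivalent to the constant positive definite matrix `M`. -/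
def IsEquivalentTo {N : ℕ} (ω : Set (Euc N)) (A : Euc N → Matrix (Fin N) (Fin N) ℝ)
    (M : Matrix (Fin N) (Fin N) ℝ) : Prop :=
  (∀ ξ : Euc N, ξ ≠ 0 → 0 < ⟪M.toEuclideanLin ξ, ξ⟫_ℝ) ∧
    ∀ ξ : Euc N, ∃ w : Euc N → ℝ, IsCellSolution ω A M ξ w

/-- Pairs (function, gradient) in `L²(ω) × L²(ω)^N`, with the norm
`(‖u‖² + ‖∇u‖²)^{1/2}` of `H¹(ω)`. -/
abbrev GraphSpace {N : ℕ} (ω : Set (Euc N)) :=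
  WithLp 2 (Lp ℂ 2 (volume.restrict ω) × Lp (EuclideanSpace ℂ (Fin N)) 2 (volume.restrict ω))

/-- The pair `p = (φ, ∇φ)` on `ω` is the restriction of a function in `H¹_loc(ℝ^N)`, together with
its weak gradient, which equals the constant `c` on `ℝ^N ∖ ω`. -/
def HasBoundaryValue {N : ℕ} {ω : Set (Euc N)} (p : GraphSpace ω) (c : ℂ) : Prop :=
  ∃ (u : Euc N → ℂ) (G : Euc N → EuclideanSpace ℂ (Fin N)), IsH1loc u G ∧
    (∀ᵐ y ∂volume.restrict ωᶜ, u y = c) ∧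
    (∀ᵐ y ∂volume.restrict ω, p.fst y = u y) ∧
    (∀ᵐ y ∂volume.restrict ω, p.snd y = G y)

section H1loc

variable {N : ℕ} {𝕜 : Type*} [RCLike 𝕜]

theorem locallyIntegrable_of_memLp {F : Type*} [NormedAddCommGroup F] {u : Euc N → F}
    (h : ∀ K : Set (Euc N), IsCompact K → MemLp u 2 (volume.restrict K)) :
    LocallyIntegrable u := by
  rw [locallyIntegrable_iff]
  intro K hK
  have : IsFiniteMeasure (volume.restrict K) := ⟨by
    rw [Measure.restrict_apply_univ]; exact hK.measure_lt_top⟩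
  exact (h K hK).integrable (by norm_num)

theorem IsTestFunction.integrable_deriv_smul {ψ : Euc N → ℝ} (hψ : IsTestFunction ψ)
    {u : Euc N → 𝕜} (h : LocallyIntegrable u) (k : Fin N) :
    Integrable (fun x => (fderiv ℝ ψ x (stdVec k)) • u x) := by
  refine h.integrable_smul_left_of_hasCompactSupport ?_ (hψ.2.fderiv_apply (𝕜 := ℝ) _)
  exact (hψ.1.continuous_fderiv (by simp)).clm_apply continuous_const

theorem IsTestFunction.integrable_smul {ψ : Euc N → ℝ} (hψ : IsTestFunction ψ)
    {G : Euc N → EuclideanSpace 𝕜 (Fin N)} (h : LocallyIntegrable G) (k : Fin N) :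
    Integrable (fun x => ψ x • G x k) := by
  have h1 := h.integrable_smul_left_of_hasCompactSupport hψ.1.continuous hψ.2
  exact (EuclideanSpace.proj (𝕜 := 𝕜) k).integrable_comp h1 |>.congr
    (Eventually.of_forall fun x => rfl)

theorem IsH1loc.add {u v : Euc N → 𝕜} {G H : Euc N → EuclideanSpace 𝕜 (Fin N)}
    (hu : IsH1loc u G) (hv : IsH1loc v H) :
    IsH1loc (fun x => u x + v x) (fun x => G x + H x) where
  memLp K hK := (hu.memLp K hK).add (hv.memLp K hK)
  memLp_grad K hK := (hu.memLp_grad K hK).add (hv.memLp_grad K hK)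
  weak ψ hψ k := by
    simp only [smul_add, PiLp.add_apply]
    rw [integral_add (hψ.integrable_deriv_smul (locallyIntegrable_of_memLp hu.memLp) k)
        (hψ.integrable_deriv_smul (locallyIntegrable_of_memLp hv.memLp) k),
      integral_add (hψ.integrable_smul (locallyIntegrable_of_memLp hu.memLp_grad) k)
        (hψ.integrable_smul (locallyIntegrable_of_memLp hv.memLp_grad) k),
      hu.weak ψ hψ k, hv.weak ψ hψ k]
    ring

theorem IsH1loc.smul {u : Euc N → 𝕜} {G : Euc N → EuclideanSpace 𝕜 (Fin N)}
    (a : 𝕜) (hu : IsH1loc u G) :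
    IsH1loc (fun x => a * u x) (fun x => a • G x) where
  memLp K hK := (hu.memLp K hK).const_mul a
  memLp_grad K hK := (hu.memLp_grad K hK).const_smul a
  weak ψ hψ k := by
    have e1 : ∀ x, (fderiv ℝ ψ x (stdVec k)) • (a * u x) =
        a * ((fderiv ℝ ψ x (stdVec k)) • u x) := fun x => (mul_smul_comm _ _ _).symm
    have e2 : ∀ x, ψ x • (a • G x) k = a * (ψ x • G x k) := fun x =>
      (mul_smul_comm _ _ _).symm
    simp only [e1, e2]
    rw [integral_const_mul, integral_const_mul, hu.weak ψ hψ k, mul_neg]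

end H1loc

/-- The space `H¹_c(ω)` of functions in `H¹_loc(ℝ^N)` that are constant on `ℝ^N ∖ ω` (the constant
depends on the function), with the norm of `H¹(ω)`. An element is stored as the pair of its
restriction to `ω` and its gradient there. -/
def H1c {N : ℕ} (ω : Set (Euc N)) : Submodule ℂ (GraphSpace ω) where
  carrier := {p | ∃ c : ℂ, HasBoundaryValue p c}
  zero_mem' := by
    refine ⟨0, fun _ => 0, fun _ => 0, ?_, by simp, ?_, ?_⟩
    · exact ⟨fun _ _ => MemLp.zero', fun _ _ => MemLp.zero', fun ψ _ k => by simp⟩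
    · exact Lp.coeFn_zero ℂ 2 (volume.restrict ω)
    · exact Lp.coeFn_zero (EuclideanSpace ℂ (Fin N)) 2 (volume.restrict ω)
  add_mem' := by
    rintro p q ⟨c, u, G, h, hc, h1, h2⟩ ⟨d, v, H, h', hd, h1', h2'⟩
    refine ⟨c + d, _, _, h.add h', ?_, ?_, ?_⟩
    · filter_upwards [hc, hd] with y a b
      rw [a, b]
    · filter_upwards [h1, h1', Lp.coeFn_add p.fst q.fst] with y a b e
      simp only [WithLp.add_fst, e, Pi.add_apply, a, b]
    · filter_upwards [h2, h2', Lp.coeFn_add p.snd q.snd] with y a b e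
      simp only [WithLp.add_snd, e, Pi.add_apply, a, b]
  smul_mem' := by
    rintro a p ⟨c, u, G, h, hc, h1, h2⟩
    refine ⟨a * c, _, _, h.smul a, ?_, ?_, ?_⟩
    · filter_upwards [hc] with y e
      rw [e]
    · filter_upwards [h1, Lp.coeFn_smul a p.fst] with y b e
      simp only [WithLp.smul_fst, e, Pi.smul_apply, b, smul_eq_mul]
    · filter_upwards [h2, Lp.coeFn_smul a p.snd] with y b e
      simp only [WithLp.smul_snd, e, Pi.smul_apply, b]

/-- The values on `ω` of an element of `H¹_c(ω)`. -/
def h1Val {N : ℕ} {ω : Set (Euc N)} (φ : H1c ω) : Euc N → ℂ :=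
  (φ : GraphSpace ω).fst

/-- The weak gradient on `ω` of an element of `H¹_c(ω)`. -/
def h1Grad {N : ℕ} {ω : Set (Euc N)} (φ : H1c ω) : Euc N → EuclideanSpace ℂ (Fin N) :=
  (φ : GraphSpace ω).snd

/-- The shifted form
`a_ω(η)(φ, ψ) = ∫_ω a_{kl} (∂_l φ + i η_l φ) conj(∂_k ψ + i η_k ψ) dy`. -/
def shiftedForm {N : ℕ} {ω : Set (Euc N)} (A : Euc N → Matrix (Fin N) (Fin N) ℝ) (η : Euc N)
    (φ ψ : H1c ω) : ℂ :=
  ∫ y in ω, ∑ k, ∑ l, (A y k l : ℂ) *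
    (h1Grad φ y l + Complex.I * (η l : ℂ) * h1Val φ y) *
    (starRingEnd ℂ) (h1Grad ψ y k + Complex.I * (η k : ℂ) * h1Val ψ y)

/-- `(μ, φ)` is a Bloch eigenpair at momentum `η`: `φ ∈ H¹_c(ω)` is nonzero and
`a_ω(η)(φ, ψ) = μ ∫_ω φ conj(ψ) dy` for all `ψ ∈ H¹_c(ω)`. -/
def IsBlochEigenpair {N : ℕ} {ω : Set (Euc N)} (A : Euc N → Matrix (Fin N) (Fin N) ℝ)
    (η : Euc N) (μ : ℂ) (φ : H1c ω) : Prop :=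
  φ ≠ 0 ∧ ∀ ψ : H1c ω,
    shiftedForm A η φ ψ = μ * ∫ y in ω, h1Val φ y * (starRingEnd ℂ) (h1Val ψ y)

/-- The set of (real) Bloch eigenvalues at momentum `η`. -/
def blochEigenvalues {N : ℕ} (ω : Set (Euc N)) (A : Euc N → Matrix (Fin N) (Fin N) ℝ)
    (η : Euc N) : Set ℝ :=
  {μ | ∃ φ : H1c ω, IsBlochEigenpair A η (μ : ℂ) φ}

/-- The ground-state energy `λ₁(η)`: the smallest Bloch eigenvalue at momentum `η`. -/
def groundEnergy {N : ℕ} (ω : Set (Euc N)) (A : Euc N → Matrix (Fin N) (Fin N) ℝ)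
    (η : Euc N) : ℝ :=
  sInf (blochEigenvalues ω A η)

/-- The normalization constant `|ω|^{-1/2}`. -/
def normConst {N : ℕ} (ω : Set (Euc N)) : ℝ :=
  (volume.real ω) ^ (-(1 / 2) : ℝ)

end HSBloch

end

/-! The Bloch problem at `η` is a bounded, analytic perturbation of the problem at `0`, where the
constants form the kernel of the energy. The only obstruction to inverting the energy at `0` is thus
one-dimensional, and it is detected by the boundary value `bv`. The argument adds the rank-one form
`bv φ · conj (bv ψ)` to the form `a(η) - μ b`. At the origin the resulting operator `pencil` is
coercive, by ellipticity and a Poincaré inequality for `φ - bv φ` (`isUnit_pencil_zero`), so it is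
invertible for small `(η, μ)`, with analytic inverse.

An eigenvector solves `pencil φ = bv φ • bvRep`, hence is `bv φ` times `res = pencil⁻¹ bvRep`. So
`μ` is an eigenvalue iff `charFun (η, μ) = bv (res (η, μ))` equals one: a scalar, real, analytic
equation. Its `μ`-derivative at the origin is the squared norm of the constant one, hence nonzero
(`fderiv_charFun_zero`). The implicit function theorem gives `lam`, and `res (η, lam η)` is the
eigenvector with boundary value one. Eigenvalues are nonnegative, so one not above `lam η` stays in
the neighborhood where the implicit solution is unique; this gives minimality and simplicity
(`exists_branch`) without any compactness or spectral theorem.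

For the derivatives at `0`, `lam ≥ 0 = lam 0` forces a critical point. The eigenvalue equation
differentiated once says that the flux of `∇ D_k φ + i e_k` is orthogonal to all gradients of
`H¹_c(ω)`. The function `i (w_{e_k} - y_k)` solves the same problem with boundary value zero, so it
equals `D_k φ` (`IsBranch.fderiv_eq`). Testing the eigenvalue equation with the constant and
differentiating twice expresses the Hessian through mean fluxes, and equivalence to `M` makes the
mean of `A ∇w_ξ` over `ω` equal to `M ξ` (`IsCellPair.integral_flux`).

Two analytic facts support this. A Lipschitz boundary is Lebesgue null, so gradients of functions
constant off `ω` vanish almost everywhere there. Weak identities against smooth functions extend to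
compactly supported `H¹` functions (`IsH1loc.integral_eq_zero_of_test`), which yields both the
Poincaré inequality and the orthogonality of fluxes to gradients. -/

namespace HSBloch

/-! ### Extending weak identities from test functions to compactly supported `H¹` functions -/

section WeakExtension

variable {N : ℕ}

theorem IsTestFunction.differentiable {ψ : Euc N → ℝ} (hψ : IsTestFunction ψ) :
    Differentiable ℝ ψ :=
  hψ.1.differentiable (by simp)

theorem IsTestFunction.integral_fderiv {ψ : Euc N → ℝ} (hψ : IsTestFunction ψ) (v : Euc N) :
    ∫ x, fderiv ℝ ψ x v = 0 := by
  have hc : Continuous fun x => fderiv ℝ ψ x v :=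
    (hψ.1.continuous_fderiv (by simp)).clm_apply continuous_const
  have h := integral_mul_fderiv_eq_neg_fderiv_mul_of_integrable (μ := (volume : Measure (Euc N)))
    (f := fun _ : Euc N => (1 : ℝ)) (g := ψ) (v := v) (by simp)
    (by simpa using hc.integrable_of_hasCompactSupport (hψ.2.fderiv_apply (𝕜 := ℝ) _))
    (by simpa using hψ.1.continuous.integrable_of_hasCompactSupport hψ.2)
    (fun x _ => differentiableAt_const _) (fun x _ => hψ.differentiable x)
  simpa using h

theorem IsTestFunction.comp_const_sub {ψ : Euc N → ℝ} (hψ : IsTestFunction ψ) (x : Euc N) :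
    IsTestFunction fun t => ψ (x - t) :=
  ⟨hψ.1.comp (contDiff_const.sub contDiff_id),
    hψ.2.comp_homeomorph (Homeomorph.subLeft x)⟩

theorem IsTestFunction.fderiv_comp_const_sub {ψ : Euc N → ℝ} (hψ : IsTestFunction ψ)
    (x t v : Euc N) : fderiv ℝ (fun t => ψ (x - t)) t v = - fderiv ℝ ψ (x - t) v := by
  have h1 : HasFDerivAt (fun t : Euc N => x - t) (-ContinuousLinearMap.id ℝ (Euc N)) t := by
    simpa using (hasFDerivAt_id t).const_sub x
  have h := (hψ.differentiable (x - t)).hasFDerivAt.comp t h1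
  have h2 : fderiv ℝ (fun t => ψ (x - t)) t = _ := h.fderiv
  rw [h2]
  simp

/-- Continuity of the correlation of two square integrable functions. -/
theorem continuous_integral_mul_sub {f u : Euc N → ℝ} (hf : MemLp f 2) (hu : MemLp u 2) :
    Continuous fun t => ∫ x, f x * u (x - t) := by
  have hmp : ∀ t : Euc N, MeasurePreserving (fun x : Euc N => x - t) volume volume :=
    fun t => measurePreserving_sub_right volume t
  let g : C(Euc N, C(Euc N, Euc N)) :=
    (ContinuousMap.mk (fun a : Euc N × Euc N => a.2 - a.1)
      (continuous_snd.sub continuous_fst)).curry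
  have hc : Continuous fun t => Lp.compMeasurePreserving (g t) (hmp t) (hu.toLp u) :=
    Continuous.compMeasurePreservingLp continuous_const g.continuous hmp (by norm_num)
  have hc2 : Continuous fun t =>
      ⟪Lp.compMeasurePreserving (g t) (hmp t) (hu.toLp u), hf.toLp f⟫_ℝ :=
    hc.inner continuous_const
  convert hc2 using 2 with t
  rw [L2.inner_def]
  refine integral_congr_ae ?_
  filter_upwards [hf.coeFn_toLp, Lp.coeFn_compMeasurePreserving (hu.toLp u) (hmp t),
    (hmp t).quasiMeasurePreserving.ae hu.coeFn_toLp] with x h1 h2 h3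
  have h2' : (Lp.compMeasurePreserving (g t) (hmp t) (hu.toLp u)) x = u (x - t) := by
    refine Eq.trans h2 ?_
    exact h3
  rw [h1, h2']
  simp

/-- Cauchy–Schwarz and translation invariance bound the inner integral uniformly in the shift, so
integrability of `ρ` suffices. This is the input to Fubini. -/
theorem integrable_mul_mul_sub {ρ f u : Euc N → ℝ} (hρ : Integrable ρ) (hf : MemLp f 2)
    (hu : MemLp u 2) :
    Integrable (fun p : Euc N × Euc N => ρ p.1 * (f p.2 * u (p.2 - p.1)))
      (volume.prod volume) := by
  have hmp : ∀ t : Euc N, MeasurePreserving (fun x : Euc N => x - t) volume volume :=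
    fun t => measurePreserving_sub_right volume t
  have hsub : Measure.QuasiMeasurePreserving (fun p : Euc N × Euc N => p.2 - p.1)
      (volume.prod volume) volume := by
    refine (quasiMeasurePreserving_sub_of_right_invariant volume volume).comp
      Measure.measurePreserving_swap.quasiMeasurePreserving
  have hmeas : AEStronglyMeasurable (fun p : Euc N × Euc N => ρ p.1 * (f p.2 * u (p.2 - p.1)))
      (volume.prod volume) :=
    hρ.1.comp_fst.mul (hf.1.comp_snd.mul (hu.1.comp_quasiMeasurePreserving hsub))
  rw [integrable_prod_iff hmeas]
  have hut : ∀ t, MemLp (fun x => u (x - t)) 2 := fun t => hu.comp_measurePreserving (hmp t)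
  refine ⟨Eventually.of_forall fun t => (hf.integrable_mul (hut t)).const_mul (ρ t), ?_⟩
  have hcont : Continuous fun t => ∫ x, ‖f x‖ * ‖u (x - t)‖ :=
    continuous_integral_mul_sub (u := fun x => ‖u x‖) hf.norm hu.norm
  have hbd : ∀ t, ‖∫ x, ‖f x‖ * ‖u (x - t)‖‖ ≤ ‖hf.norm.toLp‖ * ‖hu.norm.toLp‖ := by
    intro t
    have e : ∫ x, ‖f x‖ * ‖u (x - t)‖ = ⟪(hut t).norm.toLp, hf.norm.toLp⟫_ℝ := by
      rw [L2.inner_def]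
      refine integral_congr_ae ?_
      filter_upwards [hf.norm.coeFn_toLp, (hut t).norm.coeFn_toLp] with x h1 h2
      rw [h1, h2]; simp
    rw [e]
    refine (norm_inner_le_norm _ _).trans (le_of_eq ?_)
    rw [mul_comm]
    congr 1
    rw [Lp.norm_toLp, Lp.norm_toLp]
    congr 1
    exact eLpNorm_comp_measurePreserving hu.norm.1 (hmp t)
  have := hρ.norm.mul_bdd (c := ‖hf.norm.toLp‖ * ‖hu.norm.toLp‖) hcont.aestronglyMeasurable
    (Eventually.of_forall hbd)
  refine this.congr (Eventually.of_forall fun t => ?_)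
  simp only [norm_mul, integral_const_mul]

-- Smoothness comes from `ρ` alone, so mollifying turns a merely integrable `u` into an admissible
-- test function.
open scoped Convolution in
theorem IsTestFunction.convolution {u ρ : Euc N → ℝ} (hu : LocallyIntegrable u)
    (hc : HasCompactSupport u) (hρ : IsTestFunction ρ) :
    IsTestFunction (fun x => ∫ t, ρ t * u (x - t)) := by
  have e : (fun x => ∫ t, ρ t * u (x - t)) =
      (u ⋆[ContinuousLinearMap.mul ℝ ℝ, volume] ρ) := by
    ext x
    rw [convolution_eq_swap]
    simp [mul_comm]
  rw [e]
  exact ⟨hρ.2.contDiff_convolution_right _ hu hρ.1, hc.convolution _ hρ.2⟩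

-- The derivative falls on the smooth factor, and the weak identity for `t ↦ ρ (x - t)` moves it
-- onto `u`.
open scoped Convolution in
theorem IsH1loc.fderiv_convolution {u ρ : Euc N → ℝ} {G : Euc N → Euc N} (hu : IsH1loc u G)
    (hρ : IsTestFunction ρ) (x : Euc N) (k : Fin N) :
    fderiv ℝ (fun x => ∫ t, ρ t * u (x - t)) x (stdVec k) = ∫ t, ρ t * G (x - t) k := by
  have e : (fun x => ∫ t, ρ t * u (x - t)) =
      (u ⋆[ContinuousLinearMap.mul ℝ ℝ, volume] ρ) := by
    ext x
    rw [convolution_eq_swap]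
    simp [mul_comm]
  have hloc := locallyIntegrable_of_memLp hu.memLp
  rw [e, (hρ.2.hasFDerivAt_convolution_right _ hloc (hρ.1.of_le (by simp)) x).fderiv,
    convolution_precompR_apply _ hloc (hρ.2.fderiv ℝ) (hρ.1.continuous_fderiv (by simp))]
  have hw := hu.weak _ (hρ.comp_const_sub x) k
  simp only [hρ.fderiv_comp_const_sub, smul_eq_mul, neg_mul, integral_neg, neg_inj] at hw
  have e2 : ∫ t, ρ t * G (x - t) k = ∫ t, ρ (x - t) * G t k := by
    rw [← integral_sub_left_eq_self _ volume x]
    simp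
  rw [e2, ← hw, convolution_def]
  simp [mul_comm]

/-- An identity `∫ f ψ + F · ∇ψ = 0` valid for test functions extends to compactly supported
functions of class `H¹`. -/
theorem IsH1loc.integral_eq_zero_of_test {u : Euc N → ℝ} {G : Euc N → Euc N} (hu : IsH1loc u G)
    (hc : HasCompactSupport u) (hu2 : MemLp u 2) (hG2 : ∀ k, MemLp (fun x => G x k) 2)
    {f : Euc N → ℝ} {F : Euc N → Fin N → ℝ} (hf : MemLp f 2) (hF : ∀ k, MemLp (fun x => F x k) 2)
    (h : ∀ ψ : Euc N → ℝ, IsTestFunction ψ →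
      ∫ x, (f x * ψ x + ∑ k, F x k * fderiv ℝ ψ x (stdVec k)) = 0) :
    ∫ x, (f x * u x + ∑ k, F x k * G x k) = 0 := by
  -- `H t` is the functional evaluated at the translate of `u` by `t`. By Fubini its integral
  -- against `ρ` is the functional at the convolution of `ρ` and `u`, a test function, hence zero.
  -- Since `H` is continuous it vanishes identically, in particular at `t = 0`; no mollifier limit
  -- is needed.
  let H : Euc N → ℝ := fun t => (∫ x, f x * u (x - t)) + ∑ k, ∫ x, F x k * G (x - t) k
  have hH : Continuous H :=
    (continuous_integral_mul_sub hf hu2).add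
      (continuous_finsetSum _ fun k _ => continuous_integral_mul_sub (hF k) (hG2 k))
  have key : ∀ ρ : Euc N → ℝ, IsTestFunction ρ → ∫ t, ρ t • H t = 0 := by
    intro ρ hρ
    have hρi : Integrable ρ := hρ.1.continuous.integrable_of_hasCompactSupport hρ.2
    have hloc := locallyIntegrable_of_memLp hu.memLp
    have fub : ∀ {f u : Euc N → ℝ}, MemLp f 2 → MemLp u 2 →
        (Integrable fun t => ρ t * ∫ x, f x * u (x - t)) ∧
        (Integrable fun x => f x * ∫ t, ρ t * u (x - t)) ∧
        ∫ t, ρ t * ∫ x, f x * u (x - t) = ∫ x, f x * ∫ t, ρ t * u (x - t) := by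
      intro f u hf hu
      have hi := integrable_mul_mul_sub hρi hf hu
      have e1 : ∀ t, ∫ x, ρ t * (f x * u (x - t)) = ρ t * ∫ x, f x * u (x - t) :=
        fun t => integral_const_mul _ _
      have e2 : ∀ x, ∫ t, ρ t * (f x * u (x - t)) = f x * ∫ t, ρ t * u (x - t) := by
        intro x
        rw [← integral_const_mul]
        congr 1; ext t; ring
      refine ⟨?_, ?_, ?_⟩
      · simpa only [e1] using hi.integral_prod_left
      · simpa only [e2] using hi.integral_prod_right
      · have := integral_integral_swap (f := fun t x => ρ t * (f x * u (x - t))) hi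
        simpa only [e1, e2] using this
    have hψ := hρ.convolution hloc hc
    have h0 := h _ hψ
    simp only [hu.fderiv_convolution hρ] at h0
    have e : ∀ t, ρ t • H t = ρ t * (∫ x, f x * u (x - t)) +
        ∑ k, ρ t * ∫ x, F x k * G (x - t) k := by
      intro t
      simp only [H, smul_eq_mul, mul_add, Finset.mul_sum]
    simp only [e]
    rw [integral_add (fub hf hu2).1 (integrable_finsetSum _ fun k _ => (fub (hF k) (hG2 k)).1),
      integral_finsetSum _ fun k _ => (fub (hF k) (hG2 k)).1, (fub hf hu2).2.2]
    rw [integral_add (fub hf hu2).2.1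
      (integrable_finsetSum _ fun k _ => (fub (hF k) (hG2 k)).2.1),
      integral_finsetSum _ fun k _ => (fub (hF k) (hG2 k)).2.1] at h0
    rw [← h0]
    congr 1
    exact Finset.sum_congr rfl fun k _ => (fub (hF k) (hG2 k)).2.2
  have hae := ae_eq_zero_of_integral_contDiff_smul_eq_zero hH.locallyIntegrable
    (μ := (volume : Measure (Euc N))) (fun ρ h1 h2 => key ρ ⟨h1, h2⟩)
  have h0 : H = fun _ => 0 := (hH.ae_eq_iff_eq volume continuous_const).1 hae
  have h1 := congrFun h0 0
  simp only [H, sub_zero] at h1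
  have hi : ∀ k, Integrable fun x => F x k * G x k := fun k => (hF k).integrable_mul (hG2 k)
  have hi0 : Integrable fun x => f x * u x := hf.integrable_mul hu2
  rw [integral_add hi0 (integrable_finsetSum _ fun k _ => hi k),
    integral_finsetSum _ fun k _ => hi k]
  exact h1

end WeakExtension

/-! ### Null boundary and vanishing of gradients off the domain -/

section Boundary

variable {N : ℕ}

/-- Locally the frontier lies in the graph of `γ` over the hyperplane orthogonal to `ν`. Translates
of a graph along `ν` are pairwise disjoint, and a set with infinitely many disjoint translates by a
bounded sequence has measure zero. -/
theorem HasLipschitzBoundary.volume_frontier {ω : Set (Euc N)} (hopen : IsOpen ω)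
    (hlip : HasLipschitzBoundary ω) : volume (frontier ω) = 0 := by
  refine measure_null_of_locally_null _ fun x hx => ?_
  obtain ⟨r, hr, ν, hν, K, γ, hγ, h⟩ := hlip x hx
  set P := (ℝ ∙ ν)ᗮ.orthogonalProjectionOnto
  have hcγ : Continuous fun y => γ (P y) := hγ.continuous.comp P.continuous
  have hcν : Continuous fun y : Euc N => ⟪ν, y⟫_ℝ := continuous_const.inner continuous_id
  refine ⟨{y | γ (P y) = ⟪ν, y⟫_ℝ}, ?_, ?_⟩
  · refine mem_of_superset (inter_mem_nhdsWithin _ (Metric.ball_mem_nhds x hr)) ?_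
    rintro y ⟨hy, hyb⟩
    refine le_antisymm ?_ (not_lt.1 fun hlt => ?_)
    · have hcl : y ∈ closure (Metric.ball x r ∩ ω) :=
        Metric.isOpen_ball.inter_closure ⟨hyb, frontier_subset_closure hy⟩
      refine closure_minimal (t := {y | γ (P y) ≤ ⟪ν, y⟫_ℝ}) ?_ (isClosed_le hcγ hcν) hcl
      rintro z ⟨hzb, hz⟩
      exact ((h z hzb).1 hz).le
    · rw [hopen.frontier_eq] at hy
      exact hy.2 ((h y hyb).2 hlt)
  -- The shifts `ν / (n + 1)` are distinct and convergent, hence bounded.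
  · have htend : Tendsto (fun n : ℕ => (1 / ((n : ℝ) + 1)) • ν) atTop (𝓝 ((0 : ℝ) • ν)) :=
      tendsto_one_div_add_atTop_nhds_zero_nat.smul_const ν
    refine Measure.addHaar_eq_zero_of_disjoint_translates volume
      (fun n : ℕ => (1 / ((n : ℝ) + 1)) • ν) (Metric.isBounded_range_of_tendsto _ htend) ?_
      (isClosed_eq hcγ hcν).measurableSet
    intro m n hmn
    have hP : ∀ (t : ℝ) (y : Euc N), P (t • ν + y) = P y := by
      intro t y
      have : P ν = 0 := by
        rw [Submodule.orthogonalProjectionOnto_eq_zero_iff]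
        exact Submodule.le_orthogonal_orthogonal _ (Submodule.mem_span_singleton_self ν)
      rw [map_add, map_smul, this, smul_zero, zero_add]
    have hi : ∀ (t : ℝ) (y : Euc N), ⟪ν, t • ν + y⟫_ℝ = t + ⟪ν, y⟫_ℝ := by
      intro t y
      rw [inner_add_right, real_inner_smul_right, real_inner_self_eq_norm_sq, hν]
      ring
    simp only [Function.onFun, Set.disjoint_left, Set.singleton_add, Set.mem_image,
      Set.mem_ofPred_eq]
    rintro z ⟨y, hy, rfl⟩ ⟨y', hy', he⟩
    have h1 := congrArg P he
    have h2 := congrArg (fun z => ⟪ν, z⟫_ℝ) he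
    simp only [hP] at h1
    simp only [hi] at h2
    rw [← hy, ← hy', h1] at h2
    have h3 : 1 / ((n : ℝ) + 1) = 1 / ((m : ℝ) + 1) := add_right_cancel h2
    have h4 : (n : ℝ) + 1 = m + 1 := by
      simpa using h3
    exact hmn (by exact_mod_cast (add_right_cancel h4).symm)

theorem isH1loc_const {𝕜 : Type*} [RCLike 𝕜] (c : 𝕜) :
    IsH1loc (fun _ : Euc N => c) (fun _ => 0) where
  memLp K hK := by
    have : IsFiniteMeasure (volume.restrict K) :=
      ⟨by rw [Measure.restrict_apply_univ]; exact hK.measure_lt_top⟩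
    exact memLp_const c
  memLp_grad K hK := MemLp.zero'
  weak ψ hψ k := by
    rw [integral_smul_const, hψ.integral_fderiv]
    simp

theorem isH1loc_inner (ξ : Euc N) : IsH1loc (fun y : Euc N => ⟪ξ, y⟫_ℝ) (fun _ => ξ) where
  memLp K hK := by
    have : IsFiniteMeasure (volume.restrict K) :=
      ⟨by rw [Measure.restrict_apply_univ]; exact hK.measure_lt_top⟩
    obtain ⟨R, hR⟩ := hK.isBounded.subset_closedBall 0
    refine MemLp.of_bound (C := ‖ξ‖ * R)
      (continuous_const.inner continuous_id).aestronglyMeasurable ?_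
    refine (ae_restrict_iff' hK.measurableSet).2 (Eventually.of_forall fun y hy => ?_)
    refine (norm_inner_le_norm _ _).trans ?_
    have := hR hy
    rw [mem_closedBall_zero_iff] at this
    gcongr
  memLp_grad K hK := by
    have : IsFiniteMeasure (volume.restrict K) :=
      ⟨by rw [Measure.restrict_apply_univ]; exact hK.measure_lt_top⟩
    exact memLp_const ξ
  weak ψ hψ k := by
    have hf : ∀ x : Euc N, HasFDerivAt (fun y : Euc N => ⟪ξ, y⟫_ℝ) (innerSL ℝ ξ) x :=
      fun x => (innerSL ℝ ξ).hasFDerivAt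
    have hfd : ∀ x : Euc N, fderiv ℝ (fun y : Euc N => ⟪ξ, y⟫_ℝ) x (stdVec k) = ξ k := by
      intro x
      rw [(hf x).fderiv]
      simp [EuclideanSpace.inner_single_right]
    have hc : Continuous fun x => fderiv ℝ ψ x (stdVec k) :=
      (hψ.1.continuous_fderiv (by simp)).clm_apply continuous_const
    have hci : Continuous fun y : Euc N => ⟪ξ, y⟫_ℝ := continuous_const.inner continuous_id
    have h := integral_mul_fderiv_eq_neg_fderiv_mul_of_integrable
      (μ := (volume : Measure (Euc N))) (f := fun y : Euc N => ⟪ξ, y⟫_ℝ) (g := ψ)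
      (v := stdVec k)
      (by simp only [hfd]
          exact (hψ.1.continuous.integrable_of_hasCompactSupport hψ.2).const_mul _)
      ((hci.mul hc).integrable_of_hasCompactSupport (hψ.2.fderiv_apply (𝕜 := ℝ) _).mul_left)
      ((hci.mul hψ.1.continuous).integrable_of_hasCompactSupport hψ.2.mul_left)
      (fun x _ => (hf x).differentiableAt) (fun x _ => hψ.differentiable x)
    simp only [hfd] at h
    simp only [smul_eq_mul]
    rw [integral_congr_ae (Eventually.of_forall fun x => mul_comm _ _), h]
    simp only [mul_comm]

variable {𝕜 : Type*} [RCLike 𝕜]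

theorem IsH1loc.congr {u v : Euc N → 𝕜} {G H : Euc N → EuclideanSpace 𝕜 (Fin N)}
    (hu : IsH1loc u G) (h1 : u =ᵐ[volume] v) (h2 : G =ᵐ[volume] H) : IsH1loc v H where
  memLp K hK := (hu.memLp K hK).ae_eq (ae_restrict_of_ae h1)
  memLp_grad K hK := (hu.memLp_grad K hK).ae_eq (ae_restrict_of_ae h2)
  weak ψ hψ k := by
    have e1 : ∫ x, (fderiv ℝ ψ x (stdVec k)) • v x = ∫ x, (fderiv ℝ ψ x (stdVec k)) • u x :=
      integral_congr_ae (h1.mono fun x hx => by simp only [hx])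
    have e2 : ∫ x, ψ x • H x k = ∫ x, ψ x • G x k :=
      integral_congr_ae (h2.mono fun x hx => by simp only [hx])
    rw [e1, e2, hu.weak ψ hψ k]

theorem IsH1loc.sub {u v : Euc N → 𝕜} {G H : Euc N → EuclideanSpace 𝕜 (Fin N)}
    (hu : IsH1loc u G) (hv : IsH1loc v H) :
    IsH1loc (fun x => u x - v x) (fun x => G x - H x) := by
  simpa [sub_eq_add_neg] using hu.add (hv.smul (-1))

/-- A function of class `H¹_loc` that vanishes off `ω` has vanishing gradient off `ω`. -/
theorem IsH1loc.grad_eq_zero_off {ω : Set (Euc N)} (hnull : volume (frontier ω) = 0)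
    {u : Euc N → 𝕜} {G : Euc N → EuclideanSpace 𝕜 (Fin N)} (hu : IsH1loc u G)
    (h : ∀ᵐ y ∂volume.restrict ωᶜ, u y = 0) (hω : MeasurableSet ω) :
    ∀ᵐ y, y ∉ ω → G y = 0 := by
  rw [ae_restrict_iff' hω.compl] at h
  have hU : IsOpen (closure ω)ᶜ := isClosed_closure.isOpen_compl
  have hG : ∀ k, LocallyIntegrable (fun x => G x k) := fun k =>
    locallyIntegrable_of_memLp fun K hK => (hu.memLp_grad K hK).eval_piLp k
  -- On the open exterior the weak identity reads `∫ ψ G_k = 0`; what remains of the complement of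
  -- `ω` is the frontier, which is null.
  have key : ∀ k, ∀ᵐ y, y ∈ (closure ω)ᶜ → G y k = 0 := by
    intro k
    refine hU.ae_eq_zero_of_integral_contDiff_smul_eq_zero ((hG k).locallyIntegrableOn _) ?_
    intro ψ h1 h2 h3
    have hw := hu.weak ψ ⟨h1, h2⟩ k
    rw [integral_eq_zero_of_ae, eq_comm, neg_eq_zero] at hw
    · exact hw
    · filter_upwards [h] with y hy
      by_cases hyU : y ∈ (closure ω)ᶜ
      · have : u y = 0 := hy fun h' => hyU (subset_closure h')
        simp [this]
      · have : fderiv ℝ ψ y = 0 := by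
          by_contra hne
          exact hyU (h3 (support_fderiv_subset ℝ hne))
        simp [this]
  have hfr : ∀ᵐ y, y ∉ frontier ω := by
    rw [ae_iff]; simpa using hnull
  filter_upwards [ae_all_iff.2 key, hfr] with y hy hyf hyω
  ext k
  refine hy k fun hcl => hyf ?_
  exact ⟨hcl, fun hi => hyω (interior_subset hi)⟩

end Boundary

/-! ### Boundary values through extension by zero -/

section BoundaryValue

variable {N : ℕ} {ω : Set (Euc N)}

theorem memLp_indicator_fst_sub (hopen : IsOpen ω) (hbdd : Bornology.IsBounded ω)
    (p : GraphSpace ω) (c : ℂ) :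
    MemLp (ω.indicator fun y => p.fst y - c) 2 := by
  have : IsFiniteMeasure (volume.restrict ω) :=
    ⟨by rw [Measure.restrict_apply_univ]; exact hbdd.measure_lt_top⟩
  exact (memLp_indicator_iff_restrict hopen.measurableSet).2
    ((Lp.memLp p.fst).sub (memLp_const c))

theorem memLp_indicator_snd (hopen : IsOpen ω) (p : GraphSpace ω) :
    MemLp (ω.indicator p.snd) 2 :=
  (memLp_indicator_iff_restrict hopen.measurableSet).2 (Lp.memLp p.snd)

/-- After subtracting `c`, the witness and its gradient both vanish almost everywhere off `ω`. The
existential witness is thus replaced by a canonical one built from `p` and `c`, which makes the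
condition linear and closed. -/
theorem HasBoundaryValue.isH1loc (hopen : IsOpen ω) (hnull : volume (frontier ω) = 0)
    {p : GraphSpace ω} {c : ℂ} (h : HasBoundaryValue p c) :
    IsH1loc (ω.indicator fun y => p.fst y - c) (ω.indicator p.snd) := by
  obtain ⟨u, G, hu, hc, h1, h2⟩ := h
  have hs := hu.sub (isH1loc_const c)
  have hG := hs.grad_eq_zero_off hnull (by filter_upwards [hc] with y hy; simp [hy])
    hopen.measurableSet
  rw [ae_restrict_iff' hopen.measurableSet] at h1 h2
  rw [ae_restrict_iff' hopen.measurableSet.compl] at hc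
  refine hs.congr ?_ ?_
  · filter_upwards [hc, h1] with y hy1 hy2
    by_cases hy : y ∈ ω
    · simp [hy, hy2 hy]
    · simp [hy, hy1 hy]
  · filter_upwards [hG, h2] with y hy1 hy2
    by_cases hy : y ∈ ω
    · simp [hy, hy2 hy]
    · simp only [Set.indicator_of_notMem hy]; exact hy1 hy

theorem hasBoundaryValue_of_isH1loc (hopen : IsOpen ω)
    {p : GraphSpace ω} {c : ℂ}
    (h : IsH1loc (ω.indicator fun y => p.fst y - c) (ω.indicator p.snd)) :
    HasBoundaryValue p c := by
  refine ⟨_, _, h.add (isH1loc_const c), ?_, ?_, ?_⟩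
  · refine (ae_restrict_iff' hopen.measurableSet.compl).2 (Eventually.of_forall fun y hy => ?_)
    rw [Set.indicator_of_notMem hy]; simp
  · refine (ae_restrict_iff' hopen.measurableSet).2 (Eventually.of_forall fun y hy => ?_)
    rw [Set.indicator_of_mem hy]; simp
  · refine (ae_restrict_iff' hopen.measurableSet).2 (Eventually.of_forall fun y hy => ?_)
    rw [Set.indicator_of_mem hy]; simp

/-- The weak identity characterizing the elements of `H¹_c(ω)` with boundary value `c`. -/
theorem isH1loc_indicator_iff (hopen : IsOpen ω) (hbdd : Bornology.IsBounded ω)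
    {p : GraphSpace ω} {c : ℂ} :
    IsH1loc (ω.indicator fun y => p.fst y - c) (ω.indicator p.snd) ↔
      ∀ ψ : Euc N → ℝ, IsTestFunction ψ → ∀ k : Fin N,
        ∫ x in ω, (fderiv ℝ ψ x (stdVec k)) • (p.fst x - c) = - ∫ x in ω, ψ x • p.snd x k := by
  have e1 : ∀ (ψ : Euc N → ℝ) (k : Fin N),
      ∫ x, (fderiv ℝ ψ x (stdVec k)) • (ω.indicator fun y => p.fst y - c) x =
        ∫ x in ω, (fderiv ℝ ψ x (stdVec k)) • (p.fst x - c) := by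
    intro ψ k
    rw [← integral_indicator hopen.measurableSet]
    congr 1; ext x
    by_cases hx : x ∈ ω <;> simp [hx]
  have e2 : ∀ (ψ : Euc N → ℝ) (k : Fin N),
      ∫ x, ψ x • (ω.indicator p.snd) x k = ∫ x in ω, ψ x • p.snd x k := by
    intro ψ k
    rw [← integral_indicator hopen.measurableSet]
    congr 1; ext x
    by_cases hx : x ∈ ω <;> simp [hx]
  constructor
  · intro h ψ hψ k
    rw [← e1, ← e2]
    exact h.weak ψ hψ k
  · intro h
    refine ⟨fun K _ => (memLp_indicator_fst_sub hopen hbdd p c).restrict K,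
      fun K _ => (memLp_indicator_snd hopen p).restrict K, fun ψ hψ k => ?_⟩
    rw [e1, e2]
    exact h ψ hψ k

end BoundaryValue

/-! ### Poincaré inequality for compactly supported functions -/

section Poincare

variable {N : ℕ}

theorem IsH1loc.map {u : Euc N → ℂ} {G : Euc N → EuclideanSpace ℂ (Fin N)} (hu : IsH1loc u G)
    (L : ℂ →L[ℝ] ℝ) :
    IsH1loc (fun x => L (u x)) (fun x => (WithLp.toLp 2 fun k => L (G x k) : Euc N)) where
  memLp K hK := L.comp_memLp' (hu.memLp K hK)
  memLp_grad K hK := MemLp.of_eval_piLp fun k => L.comp_memLp' ((hu.memLp_grad K hK).eval_piLp k)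
  weak ψ hψ k := by
    have h := congrArg L (hu.weak ψ hψ k)
    rw [map_neg, ← L.integral_comp_comm, ← L.integral_comp_comm] at h
    · simpa only [map_smul] using h
    · exact hψ.integrable_smul (locallyIntegrable_of_memLp hu.memLp_grad) k
    · exact hψ.integrable_deriv_smul (locallyIntegrable_of_memLp hu.memLp) k

theorem IsTestFunction.mul_clm {ψ : Euc N → ℝ} (hψ : IsTestFunction ψ) (ℓ : Euc N →L[ℝ] ℝ) :
    IsTestFunction fun y => ℓ y * ψ y :=
  ⟨ℓ.contDiff.mul hψ.1, hψ.2.mul_left⟩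

theorem IsTestFunction.fderiv_mul_clm {ψ : Euc N → ℝ} (hψ : IsTestFunction ψ)
    (ℓ : Euc N →L[ℝ] ℝ) (x v : Euc N) :
    fderiv ℝ (fun y => ℓ y * ψ y) x v = ℓ v * ψ x + ℓ x * fderiv ℝ ψ x v := by
  have h := (ℓ.hasFDerivAt (x := x)).mul (hψ.differentiable x).hasFDerivAt
  have h2 : fderiv ℝ (fun y => ℓ y * ψ y) x = _ := h.fderiv
  rw [h2]
  simp
  ring

/-- Poincaré inequality for compactly supported functions of class `H¹`. -/
theorem IsH1loc.poincare {u : Euc N → ℝ} {G : Euc N → Euc N} (hu : IsH1loc u G) {R : ℝ}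
    (hu2 : MemLp u 2) (hG2 : MemLp G 2)
    (huR : ∀ x, x ∉ Metric.closedBall (0 : Euc N) R → u x = 0)
    (hGR : ∀ x, x ∉ Metric.closedBall (0 : Euc N) R → G x = 0) (k : Fin N) :
    ∫ x, u x ^ 2 ≤ 4 * R ^ 2 * ∫ x, (G x k) ^ 2 := by
  have hG2k : ∀ k, MemLp (fun x => G x k) 2 := fun k => hG2.eval_piLp k
  have hcs : HasCompactSupport u := HasCompactSupport.intro (isCompact_closedBall 0 R) huR
  let ℓ : Euc N →L[ℝ] ℝ := EuclideanSpace.proj k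
  have hℓ : ∀ y : Euc N, ℓ y = y k := fun y => rfl
  have hmul : ∀ {v : Euc N → ℝ}, MemLp v 2 →
      (∀ x, x ∉ Metric.closedBall (0 : Euc N) R → v x = 0) → MemLp (fun x => x k * v x) 2 := by
    intro v hv hvR
    refine hv.of_le_mul (c := R) (ℓ.continuous.aestronglyMeasurable.mul hv.1)
      (Eventually.of_forall fun x => ?_)
    by_cases hx : x ∈ Metric.closedBall (0 : Euc N) R
    · rw [norm_mul]
      have h1 : ‖x k‖ ≤ ‖x‖ := PiLp.norm_apply_le x k
      rw [mem_closedBall_zero_iff] at hx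
      gcongr
      exact h1.trans hx
    · simp [hvR x hx]
  have hf : MemLp (fun x => u x + x k * G x k) 2 :=
    hu2.add (hmul (hG2k k) fun x hx => by rw [hGR x hx]; rfl)
  have hF : ∀ j, MemLp (fun x => if j = k then x k * u x else 0) 2 := by
    intro j
    by_cases hj : j = k
    · simpa [hj] using hmul hu2 huR
    · simp [hj]
  -- The product rule `∂_k (x_k u) = u + x_k ∂_k u` in weak form, tested with `u` itself. It yields
  -- `∫ u² = -2 ∫ x_k u ∂_k u`.
  have key := hu.integral_eq_zero_of_test hcs hu2 hG2k
    (f := fun x => u x + x k * G x k) (F := fun x j => if j = k then x k * u x else 0) hf hF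
    (by
      intro ψ hψ
      have hw := hu.weak _ (hψ.mul_clm ℓ) k
      have e : ∀ x, fderiv ℝ (fun y => ℓ y * ψ y) x (stdVec k) =
          ψ x + x k * fderiv ℝ ψ x (stdVec k) := by
        intro x
        rw [hψ.fderiv_mul_clm]
        simp [hℓ]
      simp only [e] at hw
      have hi1 := (hψ.mul_clm ℓ).integrable_deriv_smul (locallyIntegrable_of_memLp hu.memLp) k
      have hi2 := (hψ.mul_clm ℓ).integrable_smul (locallyIntegrable_of_memLp hu.memLp_grad) k
      simp only [e] at hi1 hi2
      rw [eq_neg_iff_add_eq_zero, ← integral_add hi1 hi2] at hw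
      refine Eq.trans ?_ hw
      congr 1
      ext x
      simp only [ite_mul, zero_mul, Finset.sum_ite_eq', Finset.mem_univ, if_true, smul_eq_mul,
        hℓ]
      ring)
  have hiu : Integrable fun x => u x ^ 2 := hu2.integrable_sq
  have hiG : Integrable fun x => G x k ^ 2 := (hG2k k).integrable_sq
  -- Pointwise Young inequality `2 x_k u G_k ≥ -u²/2 - 2 x_k² G_k²`, with `|x_k| ≤ R` on the
  -- support.
  have hle : ∫ x, (u x ^ 2 - (1 / 2 * u x ^ 2 + 2 * R ^ 2 * G x k ^ 2)) ≤
      ∫ x, ((u x + x k * G x k) * u x + ∑ j, (if j = k then x k * u x else 0) * G x j) := by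
    refine integral_mono (hiu.sub ((hiu.const_mul _).add (hiG.const_mul _))) ?_ fun x => ?_
    · have h1 : Integrable fun x => (u x + x k * G x k) * u x := hf.integrable_mul hu2
      have h2 : Integrable fun x => ∑ j, (if j = k then x k * u x else 0) * G x j :=
        integrable_finsetSum _ fun j _ => (hF j).integrable_mul (hG2k j)
      exact h1.add h2
    · simp only [ite_mul, zero_mul, Finset.sum_ite_eq', Finset.mem_univ, if_true]
      by_cases hx : x ∈ Metric.closedBall (0 : Euc N) R
      · have h1 : |x k| ≤ ‖x‖ := PiLp.norm_apply_le x k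
        rw [mem_closedBall_zero_iff] at hx
        have h2 : x k ^ 2 ≤ R ^ 2 := sq_le_sq' (by linarith [abs_le.1 (h1.trans hx)])
          (abs_le.1 (h1.trans hx)).2
        have h3 : x k ^ 2 * G x k ^ 2 ≤ R ^ 2 * G x k ^ 2 := by gcongr
        nlinarith [sq_nonneg (u x + 2 * x k * G x k)]
      · rw [huR x hx, hGR x hx]
        simp
  have hi1 : Integrable fun x => 1 / 2 * u x ^ 2 := hiu.const_mul _
  have hi2 : Integrable fun x => 2 * R ^ 2 * G x k ^ 2 := hiG.const_mul _
  have hi3 : Integrable fun x => 1 / 2 * u x ^ 2 + 2 * R ^ 2 * G x k ^ 2 := hi1.add hi2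
  rw [key, integral_sub hiu hi3, integral_add hi1 hi2, integral_const_mul,
    integral_const_mul] at hle
  linarith

end Poincare

/-! ### Poincaré inequality on `H¹_c(ω)` -/

section BoundaryPoincare

variable {N : ℕ} {ω : Set (Euc N)}

theorem norm_sq_lp {E : Type*} [NormedAddCommGroup E] [InnerProductSpace ℂ E]
    {μ : Measure (Euc N)} (f : Lp E 2 μ) : ‖f‖ ^ 2 = ∫ y, ‖f y‖ ^ 2 ∂μ := by
  have h : (‖f‖ ^ 2 : ℂ) = ((∫ y, ‖f y‖ ^ 2 ∂μ : ℝ) : ℂ) := by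
    have h1 : (‖f‖ ^ 2 : ℂ) = ⟪f, f⟫_ℂ := by
      rw [inner_self_eq_norm_sq_to_K]; rfl
    rw [h1, L2.inner_def, ← integral_complex_ofReal]
    congr 1; ext y
    rw [inner_self_eq_norm_sq_to_K]
    simp
  exact_mod_cast h

/-- The real inequality applies to the real and imaginary parts of `φ - c` extended by zero. The
constant depends only on a ball containing `ω`, and one partial derivative already suffices. -/
theorem HasBoundaryValue.poincare (hopen : IsOpen ω) (hnull : volume (frontier ω) = 0)
    {R : ℝ} (hR : ω ⊆ Metric.closedBall 0 R) {p : GraphSpace ω} {c : ℂ}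
    (h : HasBoundaryValue p c) (k : Fin N) :
    ∫ y in ω, ‖p.fst y - c‖ ^ 2 ≤ 4 * R ^ 2 * ‖p.snd‖ ^ 2 := by
  have hbdd : Bornology.IsBounded ω := Metric.isBounded_closedBall.subset hR
  have h1 := h.isH1loc hopen hnull
  have hm1 := memLp_indicator_fst_sub hopen hbdd p c
  have hm2 := memLp_indicator_snd hopen p
  have hω : ∀ x, x ∉ Metric.closedBall (0 : Euc N) R → x ∉ ω := fun x hx hxω => hx (hR hxω)
  have key : ∀ L : ℂ →L[ℝ] ℝ,
      ∫ x in ω, L (p.fst x - c) ^ 2 ≤ 4 * R ^ 2 * ∫ x in ω, L (p.snd x k) ^ 2 := by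
    intro L
    have := (h1.map L).poincare (R := R) (L.comp_memLp' hm1)
      (MemLp.of_eval_piLp fun k => L.comp_memLp' (hm2.eval_piLp k))
      (fun x hx => by rw [Set.indicator_of_notMem (hω x hx), map_zero])
      (fun x hx => by
        ext j
        simp [Set.indicator_of_notMem (hω x hx)]) k
    rw [← integral_indicator hopen.measurableSet, ← integral_indicator hopen.measurableSet]
    refine le_of_eq_of_le ?_ (this.trans_eq ?_)
    · congr 1; ext x; by_cases hx : x ∈ ω <;> simp [hx]
    · congr 2; ext x; by_cases hx : x ∈ ω <;> simp [hx]
  have : IsFiniteMeasure (volume.restrict ω) :=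
    ⟨by rw [Measure.restrict_apply_univ]; exact hbdd.measure_lt_top⟩
  have hmu : MemLp (fun y => p.fst y - c) 2 (volume.restrict ω) :=
    (Lp.memLp p.fst).sub (memLp_const c)
  have hmG : MemLp (fun y => p.snd y k) 2 (volume.restrict ω) := (Lp.memLp p.snd).eval_piLp k
  have split : ∀ {v : Euc N → ℂ}, MemLp v 2 (volume.restrict ω) →
      ∫ y in ω, ‖v y‖ ^ 2 = (∫ y in ω, Complex.reCLM (v y) ^ 2) +
        ∫ y in ω, Complex.imCLM (v y) ^ 2 := by
    intro v hv
    have hi1 : Integrable (fun y => Complex.reCLM (v y) ^ 2) (volume.restrict ω) :=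
      (Complex.reCLM.comp_memLp' hv).integrable_sq
    have hi2 : Integrable (fun y => Complex.imCLM (v y) ^ 2) (volume.restrict ω) :=
      (Complex.imCLM.comp_memLp' hv).integrable_sq
    rw [← integral_add hi1 hi2]
    congr 1; ext y
    rw [Complex.sq_norm, Complex.normSq_apply]
    simp [sq]
  have hle : ∫ y in ω, ‖p.snd y k‖ ^ 2 ≤ ‖p.snd‖ ^ 2 := by
    rw [norm_sq_lp]
    refine integral_mono hmG.norm.integrable_sq (Lp.memLp p.snd).norm.integrable_sq fun y => ?_
    have := PiLp.norm_apply_le (p.snd y) k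
    simp only
    gcongr
  rw [split hmu]
  have h2 := key Complex.reCLM
  have h3 := key Complex.imCLM
  have h4 := split hmG
  have : 4 * R ^ 2 * ∫ y in ω, ‖p.snd y k‖ ^ 2 ≤ 4 * R ^ 2 * ‖p.snd‖ ^ 2 := by gcongr
  rw [h4, mul_add] at this
  linarith

end BoundaryPoincare

/-! ### Fluxes of the cell solutions -/

section Cell

variable {N : ℕ} {ω : Set (Euc N)}

theorem toEuclideanLin_coord (B : Matrix (Fin N) (Fin N) ℝ) (ξ : Euc N) (k : Fin N) :
    B.toEuclideanLin ξ k = ∑ l, B k l * ξ l := by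
  simp [Matrix.toLpLin_apply, Matrix.mulVec, dotProduct]

theorem IsCoefficient.entry_le {α β : ℝ} {A : Euc N → Matrix (Fin N) (Fin N) ℝ}
    (hA : IsCoefficient α β ω A) : ∀ᵐ y ∂volume.restrict ω, ∀ k l, ‖A y k l‖ ≤ β := by
  filter_upwards [hA.upper] with y hy k l
  have h1 : (A y).toEuclideanLin (stdVec l) k = A y k l := by
    rw [toEuclideanLin_coord]
    simp
  rw [← h1]
  refine (PiLp.norm_apply_le _ k).trans ((hy _).trans ?_)
  simp

/-- Smooth cutoff functions equal to one near a bounded open set. -/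
theorem exists_cutoff (hopen : IsOpen ω) (hbdd : Bornology.IsBounded ω) :
    ∃ χ : Euc N → ℝ, IsTestFunction χ ∧ (∀ y ∈ ω, χ y = 1) ∧ ∀ y ∈ ω, fderiv ℝ χ y = 0 := by
  obtain ⟨R, hR, hωR⟩ := hbdd.subset_closedBall_lt 0 (0 : Euc N)
  let b : ContDiffBump (0 : Euc N) := ⟨R, R + 1, hR, by linarith⟩
  have h1 : ∀ y ∈ ω, b y = 1 := fun y hy => b.one_of_mem_closedBall (hωR hy)
  refine ⟨b, ⟨b.contDiff, b.hasCompactSupport⟩, h1, fun y hy => ?_⟩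
  have : (b : Euc N → ℝ) =ᶠ[𝓝 y] fun _ => 1 := by
    filter_upwards [hopen.mem_nhds hy] with z hz using h1 z hz
  rw [this.fderiv_eq]
  simp

/-- Test the weak identity with a cutoff equal to one on `ω`: the term carrying its derivative
disappears. -/
theorem HasBoundaryValue.integral_snd (hopen : IsOpen ω) (hbdd : Bornology.IsBounded ω)
    (hnull : volume (frontier ω) = 0) {p : GraphSpace ω} {c : ℂ} (h : HasBoundaryValue p c)
    (k : Fin N) : ∫ y in ω, p.snd y k = 0 := by
  obtain ⟨χ, hχ, h1, h2⟩ := exists_cutoff hopen hbdd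
  have hw := (isH1loc_indicator_iff hopen hbdd).1 (h.isH1loc hopen hnull) χ hχ k
  rw [setIntegral_congr_fun (g := fun _ => (0 : ℂ)) hopen.measurableSet
      (fun y hy => by simp [h2 y hy]),
    setIntegral_congr_fun (f := fun y => χ y • p.snd y k) (g := fun y => p.snd y k)
      hopen.measurableSet (fun y hy => by simp [h1 y hy])] at hw
  simpa using hw.symm

/-- A function of `H¹_c(ω)` minus its boundary value is compactly supported and of class `H¹`, so
its real and imaginary parts are admissible in a square integrable divergence-free identity. -/
theorem HasBoundaryValue.integral_flux_eq_zero (hopen : IsOpen ω)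
    (hbdd : Bornology.IsBounded ω) (hnull : volume (frontier ω) = 0) {p : GraphSpace ω} {c : ℂ}
    (h : HasBoundaryValue p c) {F : Euc N → Fin N → ℝ} (hF : ∀ k, MemLp (fun x => F x k) 2)
    (hz : ∀ ψ : Euc N → ℝ, IsTestFunction ψ →
      ∫ x, ∑ k, F x k * fderiv ℝ ψ x (stdVec k) = 0) :
    ∫ y in ω, ∑ k, (F y k : ℂ) * p.snd y k = 0 := by
  have h1 := h.isH1loc hopen hnull
  have hm1 := memLp_indicator_fst_sub hopen hbdd p c
  have hm2 := memLp_indicator_snd hopen p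
  have hcl : IsCompact (closure ω) := hbdd.isCompact_closure
  have hi : Integrable (fun y => ∑ k, (F y k : ℂ) * p.snd y k) (volume.restrict ω) :=
    integrable_finsetSum _ fun k _ =>
      ((hF k).restrict ω).ofReal.integrable_mul ((Lp.memLp p.snd).eval_piLp k)
  have key : ∀ L : ℂ →L[ℝ] ℝ, L (∫ y in ω, ∑ k, (F y k : ℂ) * p.snd y k) = 0 := by
    intro L
    have hm := (h1.map L).integral_eq_zero_of_test (f := fun _ => 0) (F := F)
      (HasCompactSupport.intro hcl fun x hx => by
        rw [Set.indicator_of_notMem (fun h' => hx (subset_closure h')), map_zero])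
      (L.comp_memLp' hm1) (fun k => L.comp_memLp' (hm2.eval_piLp k)) MemLp.zero' hF
      (by simpa using hz)
    rw [← L.integral_comp_comm hi, ← integral_indicator hopen.measurableSet]
    refine Eq.trans ?_ hm
    congr 1
    ext x
    by_cases hx : x ∈ ω
    · have e : ∀ (a : ℝ) (z : ℂ), L ((a : ℂ) * z) = a * L z := by
        intro a z
        rw [← Complex.real_smul, map_smul, smul_eq_mul]
      simp [hx, e]
    · simp [hx]
  refine Complex.ext ?_ ?_
  · simpa using key Complex.reCLM
  · simpa using key Complex.imCLM

/-- The data of a function `w_ξ` together with its weak gradient. -/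
structure IsCellPair (ω : Set (Euc N)) (A : Euc N → Matrix (Fin N) (Fin N) ℝ)
    (M : Matrix (Fin N) (Fin N) ℝ) (ξ : Euc N) (w : Euc N → ℝ) (G : Euc N → Euc N) : Prop where
  isH1loc : IsH1loc w G
  weak : ∀ ψ : Euc N → ℝ, IsTestFunction ψ →
    ∫ y, ∑ k, ∑ l, extendCoeff ω A M y k l * G y l * fderiv ℝ ψ y (stdVec k) = 0
  off : ∀ᵐ y ∂volume.restrict ωᶜ, w y = ⟪ξ, y⟫_ℝ

variable {α β : ℝ} {A : Euc N → Matrix (Fin N) (Fin N) ℝ} {M : Matrix (Fin N) (Fin N) ℝ}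
  {ξ : Euc N} {w : Euc N → ℝ} {G : Euc N → Euc N}

theorem memLp_restrict_of_isBounded {E : Type*} [NormedAddCommGroup E] {f : Euc N → E}
    (hbdd : Bornology.IsBounded ω)
    (h : ∀ K : Set (Euc N), IsCompact K → MemLp f 2 (volume.restrict K)) :
    MemLp f 2 (volume.restrict ω) :=
  (h _ hbdd.isCompact_closure).mono_measure (Measure.restrict_mono_set _ subset_closure)

theorem IsCoefficient.memLp_mul (hA : IsCoefficient α β ω A) {v : Euc N → ℝ}
    (hv : MemLp v 2 (volume.restrict ω)) (k l : Fin N) :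
    MemLp (fun y => A y k l * v y) 2 (volume.restrict ω) := by
  refine hv.of_le_mul (c := β) ((hA.measurable k l).mul hv.1) ?_
  filter_upwards [hA.entry_le] with y hy
  rw [norm_mul]
  gcongr
  exact hy k l

theorem IsCellPair.grad_off (hopen : IsOpen ω) (hnull : volume (frontier ω) = 0)
    (hw : IsCellPair ω A M ξ w G) : ∀ᵐ y, y ∉ ω → G y = ξ := by
  have h := (hw.isH1loc.sub (isH1loc_inner ξ)).grad_eq_zero_off hnull
    (by filter_upwards [hw.off] with y hy; rw [hy, sub_self]) hopen.measurableSet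
  filter_upwards [h] with y hy hyω using sub_eq_zero.1 (hy hyω)

/-- The difference between the flux `A ∇w_ξ` and the constant flux `M ξ`, extended by zero. -/
noncomputable def fluxDefect (ω : Set (Euc N)) (A : Euc N → Matrix (Fin N) (Fin N) ℝ)
    (M : Matrix (Fin N) (Fin N) ℝ) (ξ : Euc N) (G : Euc N → Euc N) (y : Euc N) (k : Fin N) : ℝ :=
  ω.indicator (fun y => (∑ l, A y k l * G y l) - ∑ l, M k l * ξ l) y

theorem IsCellPair.memLp_flux (hbdd : Bornology.IsBounded ω)
    (hA : IsCoefficient α β ω A) (hw : IsCellPair ω A M ξ w G) (k : Fin N) :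
    MemLp (fun y => ∑ l, A y k l * G y l) 2 (volume.restrict ω) :=
  memLp_finsetSum _ fun l _ =>
    hA.memLp_mul ((memLp_restrict_of_isBounded hbdd hw.isH1loc.memLp_grad).eval_piLp l) k l

theorem IsCellPair.memLp_fluxDefect (hopen : IsOpen ω) (hbdd : Bornology.IsBounded ω)
    (hA : IsCoefficient α β ω A) (hw : IsCellPair ω A M ξ w G) (k : Fin N) :
    MemLp (fun y => fluxDefect ω A M ξ G y k) 2 := by
  have : IsFiniteMeasure (volume.restrict ω) :=
    ⟨by rw [Measure.restrict_apply_univ]; exact hbdd.measure_lt_top⟩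
  exact (memLp_indicator_iff_restrict hopen.measurableSet).2
    ((hw.memLp_flux hbdd hA k).sub (memLp_const _))

theorem IsTestFunction.memLp_fderiv {ψ : Euc N → ℝ} (hψ : IsTestFunction ψ) (v : Euc N) :
    MemLp (fun x => fderiv ℝ ψ x v) 2 :=
  ((hψ.1.continuous_fderiv (by simp)).clm_apply continuous_const).memLp_of_hasCompactSupport
    (hψ.2.fderiv_apply (𝕜 := ℝ) _)

/-- Both the flux of `w_ξ` and the constant field `M ξ` are divergence free on the whole space, and
they coincide off `ω` because `∇w_ξ = ξ` there. Their difference is thus divergence free, supported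
in `ω` and globally square integrable. -/
theorem IsCellPair.integral_fluxDefect (hopen : IsOpen ω) (hbdd : Bornology.IsBounded ω)
    (hnull : volume (frontier ω) = 0)
    (hA : IsCoefficient α β ω A) (hw : IsCellPair ω A M ξ w G) {ψ : Euc N → ℝ}
    (hψ : IsTestFunction ψ) :
    ∫ x, ∑ k, fluxDefect ω A M ξ G x k * fderiv ℝ ψ x (stdVec k) = 0 := by
  have hd : ∀ k, Integrable fun x => fderiv ℝ ψ x (stdVec k) := fun k =>
    ((hψ.1.continuous_fderiv (by simp)).clm_apply continuous_const).integrable_of_hasCompactSupport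
      (hψ.2.fderiv_apply (𝕜 := ℝ) _)
  have hi1 : Integrable fun x => ∑ k, fluxDefect ω A M ξ G x k * fderiv ℝ ψ x (stdVec k) :=
    integrable_finsetSum _ fun k _ =>
      (hw.memLp_fluxDefect hopen hbdd hA k).integrable_mul (hψ.memLp_fderiv _)
  have hi2 : Integrable fun x => ∑ k, (∑ l, M k l * ξ l) * fderiv ℝ ψ x (stdVec k) :=
    integrable_finsetSum _ fun k _ => (hd k).const_mul _
  have h0 : ∫ x, ∑ k, (∑ l, M k l * ξ l) * fderiv ℝ ψ x (stdVec k) = 0 := by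
    rw [integral_finsetSum _ fun k _ => (hd k).const_mul _]
    refine Finset.sum_eq_zero fun k _ => ?_
    rw [integral_const_mul, hψ.integral_fderiv, mul_zero]
  have h1 := hw.weak ψ hψ
  have e : (fun y => ∑ k, ∑ l, extendCoeff ω A M y k l * G y l * fderiv ℝ ψ y (stdVec k))
      =ᵐ[volume] fun y => (∑ k, fluxDefect ω A M ξ G y k * fderiv ℝ ψ y (stdVec k)) +
        ∑ k, (∑ l, M k l * ξ l) * fderiv ℝ ψ y (stdVec k) := by
    filter_upwards [hw.grad_off hopen hnull] with y hy
    rw [← Finset.sum_add_distrib]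
    refine Finset.sum_congr rfl fun k _ => ?_
    rw [← Finset.sum_mul, ← add_mul]
    congr 1
    by_cases hyω : y ∈ ω
    · simp [fluxDefect, extendCoeff, hyω]
    · simp [fluxDefect, extendCoeff, hyω, hy hyω]
  rw [integral_congr_ae e, integral_add hi1 hi2, h0, add_zero] at h1
  exact h1

/-- The flux `A ∇w_ξ` is orthogonal to the gradients of `H¹_c(ω)`. -/
theorem IsCellPair.integral_flux_mul_snd (hopen : IsOpen ω) (hbdd : Bornology.IsBounded ω)
    (hnull : volume (frontier ω) = 0)
    (hA : IsCoefficient α β ω A) (hw : IsCellPair ω A M ξ w G) {p : GraphSpace ω} {c : ℂ}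
    (h : HasBoundaryValue p c) :
    ∫ y in ω, ∑ k, ((∑ l, A y k l * G y l : ℝ) : ℂ) * p.snd y k = 0 := by
  have h1 := h.integral_flux_eq_zero hopen hbdd hnull (hw.memLp_fluxDefect hopen hbdd hA)
    fun ψ hψ => hw.integral_fluxDefect hopen hbdd hnull hA hψ
  have : IsFiniteMeasure (volume.restrict ω) :=
    ⟨by rw [Measure.restrict_apply_univ]; exact hbdd.measure_lt_top⟩
  have hsnd : ∀ k, Integrable (fun y => p.snd y k) (volume.restrict ω) := fun k =>
    ((Lp.memLp p.snd).eval_piLp k).integrable (by norm_num)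
  have hi1 : Integrable (fun y => ∑ k, (fluxDefect ω A M ξ G y k : ℂ) * p.snd y k)
      (volume.restrict ω) :=
    integrable_finsetSum _ fun k _ =>
      ((hw.memLp_fluxDefect hopen hbdd hA k).restrict ω).ofReal.integrable_mul
        ((Lp.memLp p.snd).eval_piLp k)
  have hi2 : Integrable (fun y => ∑ k, ((∑ l, M k l * ξ l : ℝ) : ℂ) * p.snd y k)
      (volume.restrict ω) := integrable_finsetSum _ fun k _ => (hsnd k).const_mul _
  -- The constant part of the flux pairs to zero because gradients in `H¹_c(ω)` have mean zero.
  have h2 : ∫ y in ω, ∑ k, ((∑ l, M k l * ξ l : ℝ) : ℂ) * p.snd y k = 0 := by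
    rw [integral_finsetSum _ fun k _ => (hsnd k).const_mul _]
    refine Finset.sum_eq_zero fun k _ => ?_
    rw [integral_const_mul, h.integral_snd hopen hbdd hnull, mul_zero]
  have h3 := integral_add hi1 hi2
  rw [h1, h2, add_zero] at h3
  rw [← h3]
  refine setIntegral_congr_fun hopen.measurableSet fun y hy => ?_
  simp only [← Finset.sum_add_distrib, ← add_mul]
  refine Finset.sum_congr rfl fun k _ => ?_
  congr 1
  rw [← Complex.ofReal_add]
  simp [fluxDefect, hy]

/-- The mean of the flux `A ∇w_ξ` is `M ξ`. -/
theorem IsCellPair.integral_flux (hopen : IsOpen ω) (hbdd : Bornology.IsBounded ω)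
    (hnull : volume (frontier ω) = 0)
    (hA : IsCoefficient α β ω A) (hw : IsCellPair ω A M ξ w G) (k : Fin N) :
    ∫ y in ω, ∑ l, A y k l * G y l = volume.real ω * ∑ l, M k l * ξ l := by
  obtain ⟨χ, hχ, hχ1, hχ2⟩ := exists_cutoff hopen hbdd
  let ℓ : Euc N →L[ℝ] ℝ := EuclideanSpace.proj k
  -- The test function is `y_k` times a cutoff, with gradient `e_k` on `ω`; it extracts the mean of
  -- the `k`-th component.
  have h1 := hw.integral_fluxDefect hopen hbdd hnull hA (hχ.mul_clm ℓ)
  rw [← setIntegral_eq_integral_of_forall_compl_eq_zero (s := ω)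
      (fun x hx => by simp [fluxDefect, hx]),
    setIntegral_congr_fun (g := fun y => (∑ l, A y k l * G y l) - ∑ l, M k l * ξ l)
      hopen.measurableSet (fun y hy => by
        simp only [hχ.fderiv_mul_clm, hχ1 y hy, hχ2 y hy]
        simp [fluxDefect, hy, ℓ])] at h1
  have : IsFiniteMeasure (volume.restrict ω) :=
    ⟨by rw [Measure.restrict_apply_univ]; exact hbdd.measure_lt_top⟩
  rw [integral_sub ((hw.memLp_flux hbdd hA k).integrable (by norm_num)) (integrable_const _),
    setIntegral_const, smul_eq_mul] at h1
  linarith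

/-- The corrector `a (w_ξ - (ξ, ·))` as an element of `H¹_c(ω)` with boundary value zero. -/
theorem IsCellPair.exists_corrector (hbdd : Bornology.IsBounded ω) (hw : IsCellPair ω A M ξ w G) (a : ℂ) :
    ∃ p : GraphSpace ω, HasBoundaryValue p 0 ∧
      (∀ᵐ y ∂volume.restrict ω, p.fst y = a * ((w y - ⟪ξ, y⟫_ℝ : ℝ) : ℂ)) ∧
      ∀ᵐ y ∂volume.restrict ω, ∀ k, p.snd y k = a * ((G y k - ξ k : ℝ) : ℂ) := by
  have hs := hw.isH1loc.sub (isH1loc_inner ξ)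
  have hv : IsH1loc (fun y => a * ((w y - ⟪ξ, y⟫_ℝ : ℝ) : ℂ))
      (fun y => a • (WithLp.toLp 2 fun k => ((G y k - ξ k : ℝ) : ℂ) :
        EuclideanSpace ℂ (Fin N))) := by
    refine IsH1loc.smul a ⟨fun K hK => (hs.memLp K hK).ofReal, fun K hK =>
      MemLp.of_eval_piLp fun k => ((hs.memLp_grad K hK).eval_piLp k).ofReal, fun ψ hψ k => ?_⟩
    have := congrArg (fun x : ℝ => (x : ℂ)) (hs.weak ψ hψ k)
    simp only [Complex.ofReal_neg, ← integral_complex_ofReal] at this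
    simpa using this
  have h1 := memLp_restrict_of_isBounded hbdd hv.memLp
  have h2 := memLp_restrict_of_isBounded hbdd hv.memLp_grad
  refine ⟨WithLp.toLp 2 (h1.toLp, h2.toLp), ⟨_, _, hv, ?_, h1.coeFn_toLp, h2.coeFn_toLp⟩,
    h1.coeFn_toLp, ?_⟩
  · filter_upwards [hw.off] with y hy
    simp [hy]
  · filter_upwards [h2.coeFn_toLp] with y hy k
    change (h2.toLp : Euc N → EuclideanSpace ℂ (Fin N)) y k = _
    rw [hy]
    rfl

end Cell

/-! ### The abstract rank-one corrected pencil and the eigenvalue branch -/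

section Pencil

set_option linter.unusedSectionVars false

open scoped ContDiff

variable {N : ℕ} {H K₀ K₁ : Type*}
  [NormedAddCommGroup H] [InnerProductSpace ℂ H] [CompleteSpace H]
  [NormedAddCommGroup K₀] [InnerProductSpace ℂ K₀] [CompleteSpace K₀]
  [NormedAddCommGroup K₁] [InnerProductSpace ℂ K₁] [CompleteSpace K₁]

/-- Abstract data of a shifted quadratic form: a value map, a gradient, a coefficient operator,
the embeddings `f ↦ f e_k`, a boundary value functional and the constant function one. -/
structure ShiftedFormData (N : ℕ) (H K₀ K₁ : Type*)
    [NormedAddCommGroup H] [InnerProductSpace ℂ H]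
    [NormedAddCommGroup K₀] [InnerProductSpace ℂ K₀]
    [NormedAddCommGroup K₁] [InnerProductSpace ℂ K₁] where
  val : H →L[ℂ] K₀
  grad : H →L[ℂ] K₁
  coeff : K₁ →L[ℂ] K₁
  embed : Fin N → K₀ →L[ℂ] K₁
  bv : H →L[ℂ] ℂ
  one : H
  ellip : ℝ
  poin : ℝ
  ellip_pos : 0 < ellip
  coeff_symm : ∀ u v, ⟪coeff u, v⟫_ℂ = ⟪u, coeff v⟫_ℂ
  coeff_lower : ∀ u, ellip * ‖u‖ ^ 2 ≤ (⟪u, coeff u⟫_ℂ).re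
  norm_sq : ∀ φ, ‖φ‖ ^ 2 = ‖val φ‖ ^ 2 + ‖grad φ‖ ^ 2
  poincare : ∀ φ, ‖val (φ - bv φ • one)‖ ≤ poin * ‖grad φ‖
  grad_one : grad one = 0
  bv_one : bv one = 1
  val_one : val one ≠ 0

namespace ShiftedFormData

variable (D : ShiftedFormData N H K₀ K₁)

/-- The shift `φ ↦ i φ e_k`. -/
noncomputable def shift (k : Fin N) : H →L[ℂ] K₁ := Complex.I • (D.embed k ∘L D.val)

/-- The shifted gradient `∇ + iη`. -/
noncomputable def sgrad (η : Euc N) : H →L[ℂ] K₁ :=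
  D.grad + ∑ k, ((η k : ℝ) : ℂ) • D.shift k

/-- The form `a(η)(φ, ψ)`, linear in `φ` and conjugate linear in `ψ`. -/
noncomputable def form (η : Euc N) (φ ψ : H) : ℂ := ⟪D.sgrad η ψ, D.coeff (D.sgrad η φ)⟫_ℂ

/-- The eigenvalue equation in weak form. -/
def IsEigen (η : Euc N) (μ : ℝ) (φ : H) : Prop :=
  ∀ ψ, D.form η φ ψ = (μ : ℂ) * ⟪D.val ψ, D.val φ⟫_ℂ

open ContinuousLinearMap in
/-- The operator representing the form `a(η)`. -/
noncomputable def op (η : Euc N) : H →L[ℂ] H :=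
  (adjoint D.grad ∘L D.coeff ∘L D.grad) +
  (∑ k, η k • ((adjoint D.grad ∘L D.coeff ∘L D.shift k) +
    (adjoint (D.shift k) ∘L D.coeff ∘L D.grad))) +
  ∑ k, ∑ l, (η k * η l) • (adjoint (D.shift k) ∘L D.coeff ∘L D.shift l)

theorem inner_op (η : Euc N) (φ ψ : H) : ⟪ψ, D.op η φ⟫_ℂ = D.form η φ ψ := by
  simp only [op, form, sgrad, add_apply, sum_apply,
    smul_apply, ContinuousLinearMap.comp_apply, inner_add_left,
    inner_add_right, inner_sum, sum_inner, map_add, map_sum, map_smul, inner_smul_left,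
    inner_smul_right, ContinuousLinearMap.adjoint_inner_right, Complex.conj_ofReal,
    ← Complex.coe_smul, Finset.sum_add_distrib, smul_add, Complex.ofReal_mul]
  have e : ∀ i, (η i : ℂ) * ∑ j, (η j : ℂ) * ⟪D.shift j ψ, D.coeff (D.shift i φ)⟫_ℂ =
      ∑ j, (η j : ℂ) * (η i : ℂ) * ⟪D.shift j ψ, D.coeff (D.shift i φ)⟫_ℂ := by
    intro i
    rw [Finset.mul_sum]
    exact Finset.sum_congr rfl fun j _ => by ring
  simp only [mul_add, Finset.sum_add_distrib, e]
  rw [Finset.sum_comm]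
  ring

/-- The representative of the boundary value functional. -/
noncomputable def bvRep : H := (InnerProductSpace.toDual ℂ H).symm D.bv

theorem inner_bvRep (φ : H) : ⟪D.bvRep, φ⟫_ℂ = D.bv φ := by
  simp [bvRep]

/-- The operator pencil `a(η) - μ b + |bv|²`. -/
noncomputable def pencil (v : Euc N × ℝ) : H →L[ℂ] H :=
  D.op v.1 - v.2 • (ContinuousLinearMap.adjoint D.val ∘L D.val) +
    ContinuousLinearMap.smulRight D.bv D.bvRep

theorem inner_pencil (η : Euc N) (μ : ℝ) (φ ψ : H) :
    ⟪ψ, D.pencil (η, μ) φ⟫_ℂ = D.form η φ ψ - μ * ⟪D.val ψ, D.val φ⟫_ℂ +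
      D.bv φ * (starRingEnd ℂ) (D.bv ψ) := by
  simp only [pencil, add_apply, sub_apply,
    smul_apply, ContinuousLinearMap.smulRight_apply, inner_add_right,
    inner_sub_right, inner_op, inner_smul_right, ContinuousLinearMap.comp_apply,
    ← Complex.coe_smul, ContinuousLinearMap.adjoint_inner_right]
  rw [← inner_conj_symm ψ D.bvRep, inner_bvRep]

/-- The pencil is polynomial in `(η, μ)`. Here `ω` is the analytic smoothness exponent, not the
domain. -/
theorem contDiff_pencil : ContDiff ℝ ω D.pencil := by
  unfold pencil op
  fun_prop

theorem form_conj (η : Euc N) (φ ψ : H) :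
    (starRingEnd ℂ) (D.form η φ ψ) = D.form η ψ φ := by
  rw [form, inner_conj_symm, D.coeff_symm, form]

theorem inner_pencil_symm (v : Euc N × ℝ) (φ ψ : H) :
    ⟪D.pencil v ψ, φ⟫_ℂ = ⟪ψ, D.pencil v φ⟫_ℂ := by
  obtain ⟨η, μ⟩ := v
  rw [← inner_conj_symm, inner_pencil, inner_pencil]
  simp only [map_add, map_sub, map_mul, form_conj, Complex.conj_ofReal, inner_conj_symm,
    Complex.conj_conj]
  ring

theorem sgrad_zero : D.sgrad 0 = D.grad := by
  simp [sgrad]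

theorem sgrad_zero_one : D.sgrad 0 D.one = 0 := by
  rw [sgrad_zero, D.grad_one]

theorem le_re_form (η : Euc N) (φ : H) :
    D.ellip * ‖D.sgrad η φ‖ ^ 2 ≤ (D.form η φ φ).re := D.coeff_lower _

/-- Coercivity: the quadratic form at the origin dominates `ellip ‖grad x‖² + |bv x|²`, and by
Poincaré these two terms control `‖val x‖`, hence the full norm. The rank-one term compensates for
the kernel of `grad`. -/
theorem isUnit_pencil_zero : IsUnit (D.pencil 0) := by
  have hα := D.ellip_pos
  set m := ‖D.val D.one‖
  -- From `‖x‖² ≤ (2 poin² + 1) ‖grad x‖² + 2 m² |bv x|²`; summing the two separate constants gives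
  -- one that serves both terms.
  set K : ℝ := (2 * D.poin ^ 2 + 1) / D.ellip + 2 * m ^ 2 with hK
  have hKpos : 0 < K := by positivity
  refine ContinuousLinearMap.isUnit_of_forall_le_norm_inner_map (D.pencil 0)
    (c := ⟨K⁻¹, by positivity⟩) (by exact_mod_cast inv_pos.2 hKpos) fun x => ?_
  have h1 : ⟪x, D.pencil 0 x⟫_ℂ = D.form 0 x x + (‖D.bv x‖ ^ 2 : ℝ) := by
    have := D.inner_pencil 0 0 x x
    rw [show ((0 : Euc N), (0 : ℝ)) = 0 from rfl] at this
    rw [this, Complex.mul_conj, Complex.normSq_eq_norm_sq]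
    simp
  have h2 : D.ellip * ‖D.grad x‖ ^ 2 + ‖D.bv x‖ ^ 2 ≤ ‖⟪D.pencil 0 x, x⟫_ℂ‖ := by
    rw [D.inner_pencil_symm, h1]
    refine le_trans ?_ (Complex.re_le_norm _)
    rw [Complex.add_re, Complex.ofReal_re]
    have := D.le_re_form 0 x
    rw [sgrad_zero] at this
    linarith
  refine le_trans ?_ h2
  have h3 : ‖D.val x‖ ≤ D.poin * ‖D.grad x‖ + ‖D.bv x‖ * m := by
    have e : D.val x = D.val (x - D.bv x • D.one) + D.bv x • D.val D.one := by
      simp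
    rw [e]
    refine (norm_add_le _ _).trans ?_
    rw [norm_smul]
    exact add_le_add (D.poincare x) le_rfl
  have h4 : ‖D.val x‖ ^ 2 ≤ 2 * D.poin ^ 2 * ‖D.grad x‖ ^ 2 + 2 * m ^ 2 * ‖D.bv x‖ ^ 2 := by
    have h5 : ‖D.val x‖ ^ 2 ≤ (D.poin * ‖D.grad x‖ + ‖D.bv x‖ * m) ^ 2 := by gcongr
    nlinarith [sq_nonneg (D.poin * ‖D.grad x‖ - ‖D.bv x‖ * m)]
  have h6 : ‖x‖ ^ 2 ≤ K * (D.ellip * ‖D.grad x‖ ^ 2 + ‖D.bv x‖ ^ 2) := by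
    rw [D.norm_sq]
    have e : K * (D.ellip * ‖D.grad x‖ ^ 2 + ‖D.bv x‖ ^ 2) =
        (2 * D.poin ^ 2 + 1) * ‖D.grad x‖ ^ 2 + 2 * m ^ 2 * ‖D.bv x‖ ^ 2 +
        (2 * m ^ 2 * D.ellip * ‖D.grad x‖ ^ 2 + (2 * D.poin ^ 2 + 1) / D.ellip * ‖D.bv x‖ ^ 2) := by
      rw [hK]
      field_simp
      ring
    rw [e]
    have : 0 ≤ 2 * m ^ 2 * D.ellip * ‖D.grad x‖ ^ 2 +
      (2 * D.poin ^ 2 + 1) / D.ellip * ‖D.bv x‖ ^ 2 := by positivity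
    linarith
  change ‖x‖ ^ 2 * K⁻¹ ≤ _
  rw [mul_inv_le_iff₀ hKpos]
  linarith

/-- The rank-one term is moved to the right-hand side, so that where the pencil is invertible an
eigenvector is determined by its boundary value. -/
theorem isEigen_iff (η : Euc N) (μ : ℝ) (φ : H) :
    D.IsEigen η μ φ ↔ D.pencil (η, μ) φ = D.bv φ • D.bvRep := by
  have e : ∀ ψ, ⟪ψ, D.bv φ • D.bvRep⟫_ℂ = D.bv φ * (starRingEnd ℂ) (D.bv ψ) := by
    intro ψ
    rw [inner_smul_right, ← inner_conj_symm, inner_bvRep]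
  constructor
  · intro h
    refine ext_inner_left ℂ fun ψ => ?_
    rw [inner_pencil, h ψ, e]
    ring
  · intro h ψ
    have := congrArg (fun x => ⟪ψ, x⟫_ℂ) h
    simp only [inner_pencil, e] at this
    linear_combination this

/-- Test with `φ` itself. A negative `μ` forces `val φ = 0`; the shifted gradient then reduces to
`grad φ`, which vanishes by ellipticity. -/
theorem IsEigen.nonneg {D : ShiftedFormData N H K₀ K₁} {η : Euc N} {μ : ℝ} {φ : H}
    (h : D.IsEigen η μ φ) (hφ : φ ≠ 0) : 0 ≤ μ := by
  by_contra! hμ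
  have h1 := D.le_re_form η φ
  have hα := D.ellip_pos
  have e : (D.form η φ φ).re = μ * ‖D.val φ‖ ^ 2 := by
    rw [h φ, inner_self_eq_norm_sq_to_K, Complex.re_ofReal_mul]
    norm_cast
  rw [e] at h1
  have h2 : ‖D.val φ‖ ^ 2 = 0 := by
    by_contra hne
    have : 0 < ‖D.val φ‖ ^ 2 := lt_of_le_of_ne (sq_nonneg _) (Ne.symm hne)
    nlinarith [mul_nonneg hα.le (sq_nonneg ‖D.sgrad η φ‖)]
  have hval : D.val φ = 0 := by simpa using h2
  have h3 : D.sgrad η φ = D.grad φ := by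
    simp [sgrad, shift, hval]
  rw [h3, h2, mul_zero] at h1
  have h4 : ‖D.grad φ‖ ^ 2 ≤ 0 := nonpos_of_mul_nonpos_right h1 hα
  have h5 : ‖φ‖ ^ 2 ≤ 0 := by rw [D.norm_sq, h2]; linarith
  exact hφ (by simpa using le_antisymm h5 (sq_nonneg _))

/-- The resolvent applied to the representative of the boundary value functional. -/
noncomputable def res (v : Euc N × ℝ) : H := Ring.inverse (D.pencil v) D.bvRep

/-- The characteristic function: `μ` is a small eigenvalue at `η` iff it takes the value one. -/
noncomputable def charFun (v : Euc N × ℝ) : ℝ := (D.bv (D.res v)).re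

theorem pencil_res {v : Euc N × ℝ} (hv : IsUnit (D.pencil v)) :
    D.pencil v (D.res v) = D.bvRep := by
  have := Ring.mul_inverse_cancel _ hv
  exact congrArg (fun T : H →L[ℂ] H => T D.bvRep) this

theorem eq_res {v : Euc N × ℝ} (hv : IsUnit (D.pencil v)) {φ : H} {c : ℂ}
    (h : D.pencil v φ = c • D.bvRep) : φ = c • D.res v := by
  have := Ring.inverse_mul_cancel _ hv
  have h2 := congrArg (fun T : H →L[ℂ] H => T φ) this
  change Ring.inverse (D.pencil v) (D.pencil v φ) = φ at h2
  rw [← h2, h, map_smul, res]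

/-- The number is `⟪bvRep, pencil⁻¹ bvRep⟫` with a self-adjoint pencil, hence real. The eigenvalue
condition is therefore a single real equation, and taking real parts in `charFun` loses nothing. -/
theorem bv_res {v : Euc N × ℝ} (hv : IsUnit (D.pencil v)) :
    D.bv (D.res v) = D.charFun v := by
  refine (Complex.conj_eq_iff_re.1 ?_).symm
  rw [← D.inner_bvRep, inner_conj_symm]
  conv_lhs => rw [← D.pencil_res hv]
  conv_rhs => rw [← D.pencil_res hv]
  rw [D.inner_pencil_symm]

theorem res_zero : D.res 0 = D.one := by
  have h : D.IsEigen 0 0 D.one := by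
    intro ψ
    simp [form, sgrad_zero_one]
  have := D.eq_res D.isUnit_pencil_zero ((D.isEigen_iff 0 0 D.one).1 h)
  rw [D.bv_one, one_smul] at this
  exact this.symm

theorem contDiffAt_res {v : Euc N × ℝ} (hv : IsUnit (D.pencil v)) :
    ContDiffAt ℝ ω D.res v := by
  obtain ⟨u, hu⟩ := hv
  have h1 : ContDiffAt ℝ ω Ring.inverse (D.pencil v) := by
    rw [← hu]
    exact contDiffAt_ringInverse ℝ u
  have h2 : ContDiffAt ℝ ω (fun v => Ring.inverse (D.pencil v)) v :=
    h1.comp v D.contDiff_pencil.contDiffAt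
  exact (((ContinuousLinearMap.apply ℂ H D.bvRep).restrictScalars ℝ).contDiff.contDiffAt).comp v h2

/-- The real part of the boundary value. -/
noncomputable def bvRe : H →L[ℝ] ℝ := Complex.reCLM ∘L D.bv.restrictScalars ℝ

theorem contDiffAt_charFun {v : Euc N × ℝ} (hv : IsUnit (D.pencil v)) :
    ContDiffAt ℝ ω D.charFun v :=
  D.bvRe.contDiff.contDiffAt.comp v (D.contDiffAt_res hv)

theorem charFun_zero : D.charFun 0 = 1 := by
  rw [charFun, res_zero, bv_one, Complex.one_re]

/-- Pairing with `val one`. -/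
noncomputable def pairOne : H →L[ℝ] ℝ :=
  Complex.reCLM ∘L ((innerSL ℂ (D.val D.one)) ∘L D.val).restrictScalars ℝ

theorem pairOne_apply (x : H) : D.pairOne x = (⟪D.val D.one, D.val x⟫_ℂ).re := rfl

theorem pairOne_one : D.pairOne D.one = ‖D.val D.one‖ ^ 2 := by
  rw [pairOne_apply, inner_self_eq_norm_sq_to_K]
  norm_cast

theorem eventually_isUnit : ∀ᶠ v in 𝓝 (0 : Euc N × ℝ), IsUnit (D.pencil v) := by
  have h : {T : H →L[ℂ] H | IsUnit T} ∈ 𝓝 (D.pencil 0) :=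
    Units.isOpen.mem_nhds D.isUnit_pencil_zero
  exact D.contDiff_pencil.continuous.continuousAt.eventually h

/-- At `η = 0` the form vanishes against `one`, so pairing the equation for `res` with `one` gives
`charFun (0, t) = 1 + t * pairOne (res (0, t))`. -/
theorem fderiv_charFun_zero : fderiv ℝ D.charFun 0 (0, 1) = ‖D.val D.one‖ ^ 2 := by
  have hd : DifferentiableAt ℝ D.res 0 :=
    (D.contDiffAt_res D.isUnit_pencil_zero).differentiableAt (by simp)
  have hd' : DifferentiableAt ℝ D.charFun 0 :=
    (D.contDiffAt_charFun D.isUnit_pencil_zero).differentiableAt (by simp)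
  have h1 : HasDerivAt (fun t : ℝ => ((0 : Euc N), t)) (0, 1) 0 :=
    (hasDerivAt_const _ _).prodMk (hasDerivAt_id _)
  have hline : HasDerivAt (fun t : ℝ => D.res (0, t)) (fderiv ℝ D.res 0 (0, 1)) 0 :=
    HasFDerivAt.comp_hasDerivAt (0 : ℝ) (f := fun t : ℝ => ((0 : Euc N), t)) hd.hasFDerivAt h1
  have hchar : HasDerivAt (fun t : ℝ => D.charFun (0, t)) (fderiv ℝ D.charFun 0 (0, 1)) 0 :=
    HasFDerivAt.comp_hasDerivAt (0 : ℝ) (f := fun t : ℝ => ((0 : Euc N), t)) hd'.hasFDerivAt h1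
  have hp : HasDerivAt (fun t : ℝ => D.pairOne (D.res (0, t)))
      (D.pairOne (fderiv ℝ D.res 0 (0, 1))) 0 :=
    D.pairOne.hasFDerivAt.comp_hasDerivAt (0 : ℝ) hline
  have hprod := ((hasDerivAt_id (0 : ℝ)).mul hp).const_add 1
  have hev : (fun t : ℝ => D.charFun (0, t)) =ᶠ[𝓝 0]
      fun t => 1 + id t * D.pairOne (D.res (0, t)) := by
    have ht : Tendsto (fun t : ℝ => ((0 : Euc N), t)) (𝓝 0) (𝓝 0) :=
      h1.continuousAt.tendsto
    filter_upwards [ht.eventually D.eventually_isUnit] with t ht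
    have h2 := congrArg (fun x => ⟪D.one, x⟫_ℂ) (D.pencil_res ht)
    have h3 : D.form 0 (D.res (0, t)) D.one = 0 := by
      simp [form, sgrad_zero_one]
    have h4 : ⟪D.one, D.bvRep⟫_ℂ = 1 := by
      rw [← inner_conj_symm, inner_bvRep, bv_one, map_one]
    simp only [inner_pencil, h3, h4, bv_one, map_one] at h2
    have h5 := congrArg Complex.re h2
    simp only [Complex.add_re, Complex.sub_re, Complex.zero_re, Complex.re_ofReal_mul,
      mul_one, Complex.one_re] at h5
    rw [charFun, pairOne_apply, id]
    linarith
  have := (hprod.congr_of_eventuallyEq hev).unique hchar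
  rw [← this, show ((0 : Euc N), (0 : ℝ)) = 0 from rfl, res_zero, pairOne_one]
  simp

/-- The ground state branch: an analytic simple eigenvalue bifurcating from zero. -/
theorem exists_branch : ∃ (lam : Euc N → ℝ) (φ : Euc N → H),
    AnalyticAt ℝ lam 0 ∧ AnalyticAt ℝ φ 0 ∧ lam 0 = 0 ∧ φ 0 = D.one ∧
    ∀ᶠ η in 𝓝 (0 : Euc N), D.IsEigen η (lam η) (φ η) ∧ D.bv (φ η) = 1 ∧
      ∀ (μ : ℝ) (ψ : H), μ ≤ lam η → D.IsEigen η μ ψ → ψ ≠ 0 →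
        μ = lam η ∧ ψ = D.bv ψ • φ η := by
  have cdf : ContDiffAt ℝ ω D.charFun ((0 : Euc N), (0 : ℝ)) :=
    D.contDiffAt_charFun D.isUnit_pencil_zero
  have hm : ‖D.val D.one‖ ^ 2 ≠ 0 := by simpa using D.val_one
  -- The partial derivative in `μ` is multiplication by `‖val one‖²`, which is nonzero.
  have if₂ : (fderiv ℝ D.charFun ((0 : Euc N), (0 : ℝ)) ∘L .inr ℝ (Euc N) ℝ).IsInvertible := by
    refine ⟨ContinuousLinearEquiv.unitsEquivAut ℝ (Units.mk0 _ hm), ?_⟩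
    ext
    simp only [ContinuousLinearEquiv.coe_coe, ContinuousLinearEquiv.unitsEquivAut_apply,
      ContinuousLinearMap.comp_apply, ContinuousLinearMap.inr_apply, Units.val_mk0, one_mul]
    exact D.fderiv_charFun_zero.symm
  have pn : (ω : WithTop ℕ∞) ≠ 0 := by simp
  set lam := cdf.implicitFunction pn if₂ with hlam
  have hlam0 : lam 0 = 0 := cdf.implicitFunction_apply_self pn if₂
  have hlamC : ContDiffAt ℝ ω lam 0 := cdf.contDiffAt_implicitFunction pn if₂
  have hiff := cdf.eventually_apply_eq_iff_implicitFunction pn if₂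
  have h1 : D.charFun ((0 : Euc N), (0 : ℝ)) = 1 := D.charFun_zero
  have hpair : ContDiffAt ℝ ω (fun η : Euc N => (η, lam η)) 0 := contDiffAt_id.prodMk hlamC
  have hpair0 : ((0 : Euc N), lam 0) = 0 := by rw [hlam0]; rfl
  have hφ : ContDiffAt ℝ ω (fun η : Euc N => D.res (η, lam η)) 0 := by
    refine ContDiffAt.comp (0 : Euc N) (g := D.res) (f := fun η : Euc N => (η, lam η)) ?_ hpair
    simp only [hpair0]
    exact D.contDiffAt_res D.isUnit_pencil_zero
  refine ⟨lam, fun η => D.res (η, lam η), hlamC.analyticAt, hφ.analyticAt, hlam0, ?_, ?_⟩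
  · simp only [hpair0, res_zero]
  have hgood : ∀ᶠ v in 𝓝 ((0 : Euc N), (0 : ℝ)), IsUnit (D.pencil v) ∧
      (D.charFun v = 1 ↔ lam v.1 = v.2) := by
    filter_upwards [hiff, D.eventually_isUnit] with v hv1 hv2
    rw [h1] at hv1
    exact ⟨hv2, hv1⟩
  -- A product neighborhood is needed because, for fixed `η`, competing values of `μ` must be
  -- tested.
  rw [nhds_prod_eq, eventually_prod_iff] at hgood
  obtain ⟨P, hP, Q, hQ, hPQ⟩ := hgood
  obtain ⟨δ, hδ, hball⟩ := Metric.eventually_nhds_iff_ball.1 hQ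
  have hlt : ∀ᶠ η in 𝓝 (0 : Euc N), lam η ∈ Metric.ball (0 : ℝ) δ := by
    refine hlamC.continuousAt.eventually ?_
    rw [hlam0]
    exact Metric.ball_mem_nhds _ hδ
  filter_upwards [hP, hlt] with η hη hηδ
  obtain ⟨hu, hc⟩ := hPQ hη (hball _ hηδ)
  have hbv : D.bv (D.res (η, lam η)) = 1 := by
    rw [D.bv_res hu, hc.2 rfl, Complex.ofReal_one]
  refine ⟨?_, hbv, fun μ ψ hμ hψ hne => ?_⟩
  · rw [isEigen_iff, D.pencil_res hu, hbv, one_smul]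
  -- Nonnegativity traps `μ` in `[0, lam η]`, inside the ball where the implicit solution is unique.
  · have hμ0 := hψ.nonneg hne
    have hμδ : μ ∈ Metric.ball (0 : ℝ) δ := by
      rw [mem_ball_zero_iff, Real.norm_eq_abs, abs_lt] at hηδ ⊢
      constructor <;> linarith
    obtain ⟨hu', hc'⟩ := hPQ hη (hball _ hμδ)
    have he := D.eq_res hu' ((D.isEigen_iff η μ ψ).1 hψ)
    have hbne : D.bv ψ ≠ 0 := fun h0 => hne (by rw [he, h0, zero_smul])
    have h2 := congrArg D.bv he
    rw [map_smul, smul_eq_mul, eq_comm, mul_eq_left₀ hbne, D.bv_res hu'] at h2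
    have hμe : lam η = μ := hc'.1 (by exact_mod_cast h2)
    refine ⟨hμe.symm, ?_⟩
    rw [hμe]
    exact he

end ShiftedFormData

end Pencil

/-! ### Second derivative of an implicitly given function -/

section Hessian

variable {N : ℕ}

theorem hasFDerivAt_coord (k : Fin N) (x : Euc N) :
    HasFDerivAt (fun η : Euc N => η k) (EuclideanSpace.proj k : Euc N →L[ℝ] ℝ) x :=
  (EuclideanSpace.proj k : Euc N →L[ℝ] ℝ).hasFDerivAt

/-- The Hessian at a critical zero of a function implicitly given by `lam * h = ∑ η_k p_k`. -/
theorem hessian_of_mul_eq_sum {lam h : Euc N → ℝ} {p : Fin N → Euc N → ℝ}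
    (hlam : AnalyticAt ℝ lam 0) (hh : AnalyticAt ℝ h 0) (hp : ∀ k, AnalyticAt ℝ (p k) 0)
    (h0 : lam 0 = 0) (h1 : fderiv ℝ lam 0 = 0)
    (heq : ∀ᶠ η in 𝓝 (0 : Euc N), lam η * h η = ∑ k, η k * p k η) (i j : Fin N) :
    h 0 * iteratedFDeriv ℝ 2 lam 0 ![stdVec i, stdVec j] =
      fderiv ℝ (p j) 0 (stdVec i) + fderiv ℝ (p i) 0 (stdVec j) := by
  have hcoord : ∀ k l : Fin N, (EuclideanSpace.proj k : Euc N →L[ℝ] ℝ) (stdVec l) =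
      if k = l then 1 else 0 := by
    intro k l
    simp
  -- The identity is differentiated along `e_j` near the origin, then along `e_i` at the origin
  -- only. There the vanishing of `lam`, of its differential and of the factors `η_k` removes all
  -- second derivatives except that of `lam`.
  have hfirst : ∀ᶠ η in 𝓝 (0 : Euc N),
      lam η * fderiv ℝ h η (stdVec j) + h η * fderiv ℝ lam η (stdVec j) =
        p j η + ∑ k, η k * fderiv ℝ (p k) η (stdVec j) := by
    filter_upwards [heq.eventually_nhds, hlam.eventually_analyticAt, hh.eventually_analyticAt,
      eventually_all.2 fun k => (hp k).eventually_analyticAt] with η e a b c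
    have d1 := a.differentiableAt.hasFDerivAt.mul b.differentiableAt.hasFDerivAt
    have d2 : HasFDerivAt (fun η => ∑ k, η k * p k η) _ η :=
      HasFDerivAt.fun_sum fun k (_ : k ∈ Finset.univ) =>
        (hasFDerivAt_coord k η).mul (c k).differentiableAt.hasFDerivAt
    have := congrArg (fun L : Euc N →L[ℝ] ℝ => L (stdVec j))
      ((d2.congr_of_eventuallyEq e).unique d1)
    simp only [add_apply, smul_apply, smul_eq_mul, sum_apply, hcoord,
      Finset.sum_add_distrib, mul_ite, mul_one, mul_zero, Finset.sum_ite_eq',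
      Finset.mem_univ, if_true] at this
    rw [← this]
    ring
  have ap : ∀ {f : Euc N → ℝ}, AnalyticAt ℝ f 0 →
      HasFDerivAt (fun η => fderiv ℝ f η (stdVec j))
        ((ContinuousLinearMap.apply ℝ ℝ (stdVec j)) ∘L fderiv ℝ (fderiv ℝ f) 0) 0 := fun hf =>
    (ContinuousLinearMap.apply ℝ ℝ (stdVec j : Euc N)).hasFDerivAt.comp 0
      hf.fderiv.differentiableAt.hasFDerivAt
  have d1 := (hlam.differentiableAt.hasFDerivAt.mul (ap hh)).add
    (hh.differentiableAt.hasFDerivAt.mul (ap hlam))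
  have d2 : HasFDerivAt (fun η => p j η + ∑ k, η k * fderiv ℝ (p k) η (stdVec j)) _ 0 :=
    (hp j).differentiableAt.hasFDerivAt.add (HasFDerivAt.fun_sum fun k (_ : k ∈ Finset.univ) =>
        (hasFDerivAt_coord k 0).mul (ap (hp k)))
  have := congrArg (fun L : Euc N →L[ℝ] ℝ => L (stdVec i))
    ((d2.congr_of_eventuallyEq hfirst).unique d1)
  simp only [add_apply, smul_apply, smul_eq_mul, sum_apply, hcoord, h0, h1,
    Finset.sum_add_distrib, mul_ite, mul_one, mul_zero, Finset.sum_ite_eq', zero_mul, zero_apply,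
    Finset.mem_univ, if_true, PiLp.zero_apply, Finset.sum_const_zero, zero_add,
    ContinuousLinearMap.comp_apply, ContinuousLinearMap.apply_apply] at this
  rw [iteratedFDeriv_two_apply]
  simpa using this.symm

end Hessian

/-! ### First and second order expansion of the branch -/

section Branch

set_option linter.unusedSectionVars false

variable {H K₀ K₁ : Type*} {N : ℕ}
  [NormedAddCommGroup H] [InnerProductSpace ℂ H] [CompleteSpace H]
  [NormedAddCommGroup K₀] [InnerProductSpace ℂ K₀] [CompleteSpace K₀]
  [NormedAddCommGroup K₁] [InnerProductSpace ℂ K₁] [CompleteSpace K₁]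

namespace ShiftedFormData

variable (D : ShiftedFormData N H K₀ K₁)

/-- An analytic branch of eigenpairs issued from `(0, one)`, normalized by its boundary value. -/
structure IsBranch (lam : Euc N → ℝ) (φ : Euc N → H) : Prop where
  analytic_lam : AnalyticAt ℝ lam 0
  analytic_vec : AnalyticAt ℝ φ 0
  lam_zero : lam 0 = 0
  vec_zero : φ 0 = D.one
  isEigen : ∀ᶠ η in 𝓝 (0 : Euc N), D.IsEigen η (lam η) (φ η)
  bv_eq : ∀ᶠ η in 𝓝 (0 : Euc N), D.bv (φ η) = 1

variable {D} {lam : Euc N → ℝ} {φ : Euc N → H}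

/-- Eigenvalues are nonnegative and `lam 0 = 0`, so the origin is a local minimum. -/
theorem IsBranch.fderiv_lam (h : D.IsBranch lam φ) : fderiv ℝ lam 0 = 0 := by
  refine IsLocalMin.fderiv_eq_zero ?_
  filter_upwards [h.isEigen, h.bv_eq] with η h1 h2
  rw [h.lam_zero]
  refine h1.nonneg fun h0 => ?_
  rw [h0, map_zero] at h2
  exact zero_ne_one h2

theorem IsBranch.bv_fderiv (h : D.IsBranch lam φ) (v : Euc N) :
    D.bv (fderiv ℝ φ 0 v) = 0 := by
  have h1 : HasFDerivAt (fun η => D.bv (φ η)) ((D.bv.restrictScalars ℝ) ∘L fderiv ℝ φ 0) 0 :=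
    (D.bv.restrictScalars ℝ).hasFDerivAt.comp 0 h.analytic_vec.differentiableAt.hasFDerivAt
  have h2 : HasFDerivAt (fun η => D.bv (φ η)) (0 : Euc N →L[ℝ] ℂ) 0 :=
    (hasFDerivAt_const (1 : ℂ) (0 : Euc N)).congr_of_eventuallyEq h.bv_eq
  exact congrArg (fun L : Euc N →L[ℝ] ℂ => L v) (h1.unique h2)

theorem sgrad_smul_stdVec (t : ℝ) (k : Fin N) (x : H) :
    D.sgrad (t • stdVec k) x = D.grad x + t • D.shift k x := by
  have : ∀ l, (((t • (stdVec k : Euc N)) l : ℝ) : ℂ) = if l = k then (t : ℂ) else 0 := by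
    intro l
    by_cases hl : l = k <;> simp [hl]
  simp only [sgrad, add_apply, smul_apply, this, ite_smul, zero_smul,
    Finset.sum_ite_eq', Finset.mem_univ, if_true]
  rfl

/-- The equation satisfied by the first derivative of the eigenvector at the origin. -/
theorem IsBranch.inner_coeff_fderiv (h : D.IsBranch lam φ) (k : Fin N) (ψ : H) :
    ⟪D.grad ψ, D.coeff (D.grad (fderiv ℝ φ 0 (stdVec k)) + D.shift k D.one)⟫_ℂ = 0 := by
  have hline : HasDerivAt (fun t : ℝ => t • (stdVec k : Euc N)) (stdVec k) 0 := by
    simpa using (hasDerivAt_id (0 : ℝ)).smul_const (stdVec k : Euc N)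
  have hz : (0 : ℝ) • (stdVec k : Euc N) = 0 := zero_smul _ _
  have hφ : HasDerivAt (fun t : ℝ => φ (t • stdVec k)) (fderiv ℝ φ 0 (stdVec k)) 0 := by
    refine HasFDerivAt.comp_hasDerivAt (0 : ℝ) (l := φ) (f := fun t : ℝ => t • (stdVec k : Euc N))
      ?_ hline
    rw [hz]
    exact h.analytic_vec.differentiableAt.hasFDerivAt
  have hl : HasDerivAt (fun t : ℝ => lam (t • stdVec k)) 0 0 := by
    have := HasFDerivAt.comp_hasDerivAt (0 : ℝ) (l := lam) (l' := fderiv ℝ lam 0)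
      (f := fun t : ℝ => t • (stdVec k : Euc N))
      (by rw [hz]; exact h.analytic_lam.differentiableAt.hasFDerivAt) hline
    rw [h.fderiv_lam, zero_apply] at this
    exact this
  have hψ : HasDerivAt (fun t : ℝ => D.grad ψ + t • D.shift k ψ) (D.shift k ψ) 0 := by
    simpa using ((hasDerivAt_id (0 : ℝ)).smul_const (D.shift k ψ)).const_add (D.grad ψ)
  have hg1 : HasDerivAt (fun t : ℝ => D.grad (φ (t • stdVec k)))
      (D.grad (fderiv ℝ φ 0 (stdVec k))) 0 :=
    (D.grad.restrictScalars ℝ).hasFDerivAt.comp_hasDerivAt (0 : ℝ) hφ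
  have hg2 : HasDerivAt (fun t : ℝ => D.shift k (φ (t • stdVec k)))
      (D.shift k (fderiv ℝ φ 0 (stdVec k))) 0 :=
    ((D.shift k).restrictScalars ℝ).hasFDerivAt.comp_hasDerivAt (0 : ℝ) hφ
  have hg3 : HasDerivAt (fun t : ℝ => t • D.shift k (φ (t • stdVec k))) (D.shift k D.one) 0 := by
    have := (hasDerivAt_id (0 : ℝ)).fun_smul hg2
    simpa [hz, h.vec_zero] using this
  have hg : HasDerivAt (fun t : ℝ => D.coeff (D.grad (φ (t • stdVec k)) +
      t • D.shift k (φ (t • stdVec k))))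
      (D.coeff (D.grad (fderiv ℝ φ 0 (stdVec k)) + D.shift k D.one)) 0 :=
    (D.coeff.restrictScalars ℝ).hasFDerivAt.comp_hasDerivAt (0 : ℝ) (hg1.add hg3)
  have hlhs := hψ.inner ℂ hg
  have hv : HasDerivAt (fun t : ℝ => ⟪D.val ψ, D.val (φ (t • stdVec k))⟫_ℂ)
      ⟪D.val ψ, D.val (fderiv ℝ φ 0 (stdVec k))⟫_ℂ 0 :=
    (((innerSL ℂ (D.val ψ)) ∘L D.val).restrictScalars ℝ).hasFDerivAt.comp_hasDerivAt (0 : ℝ) hφ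
  have hrhs := (hl.ofReal_comp).mul hv
  -- The eigenvalue equation along `t e_k`. The derivative of its right side at `0` vanishes, since
  -- `lam` vanishes there to second order.
  have hev : (fun t : ℝ => ⟪D.grad ψ + t • D.shift k ψ, D.coeff (D.grad (φ (t • stdVec k)) +
      t • D.shift k (φ (t • stdVec k)))⟫_ℂ) =ᶠ[𝓝 0]
      fun t => (lam (t • stdVec k) : ℂ) * ⟪D.val ψ, D.val (φ (t • stdVec k))⟫_ℂ := by
    have ht : Tendsto (fun t : ℝ => t • (stdVec k : Euc N)) (𝓝 0) (𝓝 0) := by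
      have := hline.continuousAt.tendsto
      rwa [hz] at this
    filter_upwards [ht.eventually h.isEigen] with t ht
    have := ht ψ
    simpa only [form, sgrad_smul_stdVec] using this
  have := (hrhs.congr_of_eventuallyEq hev).unique hlhs
  rw [map_add, inner_add_right]
  simpa [hz, h.lam_zero, h.vec_zero, D.grad_one, inner_add_right] using this.symm

/-- Pairing of the flux with the shift of the constant function. -/
noncomputable def fluxPair (D : ShiftedFormData N H K₀ K₁) (k : Fin N) : K₁ →L[ℝ] ℝ :=
  Complex.reCLM ∘L ((innerSL ℂ (D.shift k D.one)) ∘L D.coeff).restrictScalars ℝ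

theorem fluxPair_apply (k : Fin N) (u : K₁) :
    D.fluxPair k u = (⟪D.shift k D.one, D.coeff u⟫_ℂ).re := rfl

/-- The Hessian of the eigenvalue at the origin. -/
theorem IsBranch.hessian (h : D.IsBranch lam φ) (i j : Fin N) :
    ‖D.val D.one‖ ^ 2 * iteratedFDeriv ℝ 2 lam 0 ![stdVec i, stdVec j] =
      D.fluxPair j (D.grad (fderiv ℝ φ 0 (stdVec i)) + D.shift i D.one) +
      D.fluxPair i (D.grad (fderiv ℝ φ 0 (stdVec j)) + D.shift j D.one) := by
  have hcl : ∀ T : H →L[ℝ] ℝ, AnalyticAt ℝ (fun η => T (φ η)) 0 := fun T =>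
    (T.analyticAt _).comp h.analytic_vec
  let S : Fin N → Fin N → H →L[ℝ] ℝ := fun k l => D.fluxPair k ∘L (D.shift l).restrictScalars ℝ
  let T : Fin N → H →L[ℝ] ℝ := fun k => D.fluxPair k ∘L D.grad.restrictScalars ℝ
  let p : Fin N → Euc N → ℝ := fun k η => T k (φ η) + ∑ l, η l * S k l (φ η)
  have hcoord : ∀ l : Fin N, AnalyticAt ℝ (fun η : Euc N => η l) 0 := fun l =>
    (EuclideanSpace.proj l : Euc N →L[ℝ] ℝ).analyticAt 0
  have hp : ∀ k, AnalyticAt ℝ (p k) 0 := fun k =>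
    (hcl _).add (Finset.analyticAt_fun_sum _ fun l _ => (hcoord l).mul (hcl _))
  have hfd : ∀ (T : H →L[ℝ] ℝ), HasFDerivAt (fun η => T (φ η)) (T ∘L fderiv ℝ φ 0) 0 := fun T =>
    T.hasFDerivAt.comp 0 h.analytic_vec.differentiableAt.hasFDerivAt
  have hpd : ∀ k l, fderiv ℝ (p k) 0 (stdVec l) =
      D.fluxPair k (D.grad (fderiv ℝ φ 0 (stdVec l)) + D.shift l D.one) := by
    intro k l
    have d : HasFDerivAt (p k) _ 0 := (hfd (T k)).add
      (HasFDerivAt.fun_sum fun m (_ : m ∈ Finset.univ) => (hasFDerivAt_coord m 0).mul (hfd (S k m)))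
    rw [d.fderiv]
    simp [h.vec_zero, T, S]
  -- Test with the constant: `grad one = 0`, so one factor `η_k` comes out of the test side and only
  -- the first derivative of `φ` enters the Hessian.
  have heq : ∀ᶠ η in 𝓝 (0 : Euc N), lam η * D.pairOne (φ η) = ∑ k, η k * p k η := by
    filter_upwards [h.isEigen] with η hη
    have h1 := congrArg Complex.re (hη D.one)
    rw [Complex.re_ofReal_mul, ← pairOne_apply] at h1
    rw [← h1]
    have e1 : D.sgrad η D.one = ∑ k, ((η k : ℝ) : ℂ) • D.shift k D.one := by
      simp [sgrad, D.grad_one]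
    have e2 : ∀ k, D.fluxPair k (D.sgrad η (φ η)) = p k η := by
      intro k
      simp only [sgrad, add_apply, sum_apply, smul_apply, map_add, map_sum, Complex.coe_smul,
        map_smul]
      rfl
    rw [form, e1, sum_inner, Complex.re_sum]
    refine Finset.sum_congr rfl fun k _ => ?_
    rw [inner_smul_left, Complex.conj_ofReal, Complex.re_ofReal_mul, ← e2]
    rfl
  have := hessian_of_mul_eq_sum h.analytic_lam (hcl D.pairOne) hp h.lam_zero h.fderiv_lam heq i j
  rw [h.vec_zero, pairOne_one, hpd, hpd] at this
  exact this

end ShiftedFormData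

end Branch

/-! ### The boundary value functional and completeness of `H¹_c(ω)` -/

section TraceFunctional

variable {N : ℕ} {ω : Set (Euc N)}

/-- The value map on `H¹_c(ω)`. -/
noncomputable def valL (ω : Set (Euc N)) : H1c ω →L[ℂ] Lp ℂ 2 (volume.restrict ω) :=
  WithLp.fstL 2 ℂ _ _ ∘L (H1c ω).subtypeL

/-- The gradient map on `H¹_c(ω)`. -/
noncomputable def gradL (ω : Set (Euc N)) :
    H1c ω →L[ℂ] Lp (EuclideanSpace ℂ (Fin N)) 2 (volume.restrict ω) :=
  WithLp.sndL 2 ℂ _ _ ∘L (H1c ω).subtypeL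

theorem gradL_apply (φ : H1c ω) : gradL ω φ = (φ : GraphSpace ω).snd := rfl

theorem norm_sq_h1c (φ : H1c ω) : ‖φ‖ ^ 2 = ‖valL ω φ‖ ^ 2 + ‖gradL ω φ‖ ^ 2 :=
  WithLp.prod_norm_sq_eq_of_L2 (φ : GraphSpace ω)

/-- The embedding `f ↦ f e_k` of scalar functions into vector fields. -/
noncomputable def embedL (ω : Set (Euc N)) (k : Fin N) :
    Lp ℂ 2 (volume.restrict ω) →L[ℂ] Lp (EuclideanSpace ℂ (Fin N)) 2 (volume.restrict ω) :=
  ((1 : ℂ →L[ℂ] ℂ).smulRight (EuclideanSpace.single k (1 : ℂ))).compLpL 2 (volume.restrict ω)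

theorem coeFn_embedL (k : Fin N) (f : Lp ℂ 2 (volume.restrict ω)) :
    ∀ᵐ y ∂volume.restrict ω, embedL ω k f y = EuclideanSpace.single k (f y) := by
  filter_upwards [ContinuousLinearMap.coeFn_compLpL
    ((1 : ℂ →L[ℂ] ℂ).smulRight (EuclideanSpace.single k (1 : ℂ))) f] with y hy
  rw [embedL, hy]
  ext l
  by_cases hl : l = k <;> simp [hl]

theorem HasBoundaryValue.add {p q : GraphSpace ω} {c d : ℂ} (hp : HasBoundaryValue p c)
    (hq : HasBoundaryValue q d) : HasBoundaryValue (p + q) (c + d) := by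
  obtain ⟨u, G, h, hc, h1, h2⟩ := hp
  obtain ⟨v, H, h', hd, h1', h2'⟩ := hq
  refine ⟨_, _, h.add h', ?_, ?_, ?_⟩
  · filter_upwards [hc, hd] with y a b
    rw [a, b]
  · filter_upwards [h1, h1', Lp.coeFn_add p.fst q.fst] with y a b e
    simp only [WithLp.add_fst, e, Pi.add_apply, a, b]
  · filter_upwards [h2, h2', Lp.coeFn_add p.snd q.snd] with y a b e
    simp only [WithLp.add_snd, e, Pi.add_apply, a, b]

theorem HasBoundaryValue.smul {p : GraphSpace ω} {c : ℂ} (a : ℂ) (hp : HasBoundaryValue p c) :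
    HasBoundaryValue (a • p) (a * c) := by
  obtain ⟨u, G, h, hc, h1, h2⟩ := hp
  refine ⟨_, _, h.smul a, ?_, ?_, ?_⟩
  · filter_upwards [hc] with y e
    rw [e]
  · filter_upwards [h1, Lp.coeFn_smul a p.fst] with y b e
    simp only [WithLp.smul_fst, e, Pi.smul_apply, b, smul_eq_mul]
  · filter_upwards [h2, Lp.coeFn_smul a p.snd] with y b e
    simp only [WithLp.smul_snd, e, Pi.smul_apply, b]

variable [IsFiniteMeasure (volume.restrict ω)]

/-- The constant function one on `ω`. -/
noncomputable def oneLp (ω : Set (Euc N)) [IsFiniteMeasure (volume.restrict ω)] :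
    Lp ℂ 2 (volume.restrict ω) := Lp.const 2 _ 1

theorem coeFn_smul_oneLp (c : ℂ) : ∀ᵐ y ∂volume.restrict ω, (c • oneLp ω) y = c := by
  filter_upwards [Lp.coeFn_smul c (oneLp ω), Lp.coeFn_const (p := 2) (μ := volume.restrict ω)
    (c := (1 : ℂ))] with y h1 h2
  rw [h1, Pi.smul_apply, oneLp, h2]
  simp

theorem norm_sq_oneLp : ‖oneLp ω‖ ^ 2 = volume.real ω := by
  have h := Lp.norm_const' (μ := volume.restrict ω) (p := 2) (c := (1 : ℂ)) (by norm_num)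
    (by norm_num)
  rw [oneLp, h, norm_one, one_mul, ← Real.rpow_natCast,
    ← Real.rpow_mul (by positivity)]
  simp

theorem norm_sub_smul_oneLp (f : Lp ℂ 2 (volume.restrict ω)) (c : ℂ) :
    ‖f - c • oneLp ω‖ ^ 2 = ∫ y in ω, ‖f y - c‖ ^ 2 := by
  rw [norm_sq_lp]
  refine integral_congr_ae ?_
  filter_upwards [Lp.coeFn_sub f (c • oneLp ω), coeFn_smul_oneLp (ω := ω) c] with y h1 h2
  rw [h1, Pi.sub_apply, h2]

theorem HasBoundaryValue.norm_sub_le (hopen : IsOpen ω) (hnull : volume (frontier ω) = 0)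
    {R : ℝ} (hR0 : 0 ≤ R) (hR : ω ⊆ Metric.closedBall 0 R) {p : GraphSpace ω} {c : ℂ}
    (h : HasBoundaryValue p c) (k : Fin N) :
    ‖p.fst - c • oneLp ω‖ ≤ 2 * R * ‖p.snd‖ := by
  have h1 := h.poincare hopen hnull hR k
  rw [← norm_sub_smul_oneLp] at h1
  refine le_of_sq_le_sq ?_ (by positivity)
  rw [mul_pow]
  linarith

theorem hasBoundaryValue_one :
    HasBoundaryValue (WithLp.toLp 2 (oneLp ω, 0) : GraphSpace ω) 1 := by
  refine ⟨fun _ => 1, fun _ => 0, isH1loc_const 1, by simp, ?_, ?_⟩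
  · filter_upwards [coeFn_smul_oneLp (ω := ω) 1] with y hy
    simpa using hy
  · exact Lp.coeFn_zero (EuclideanSpace ℂ (Fin N)) 2 (volume.restrict ω)

theorem oneLp_ne_zero (hopen : IsOpen ω) (hbdd : Bornology.IsBounded ω) (hne : ω.Nonempty) :
    oneLp ω ≠ 0 := by
  intro h0
  have h1 := norm_sq_oneLp (ω := ω)
  rw [h0, norm_zero, eq_comm] at h1
  have h2 : volume.real ω = 0 := by simpa using h1
  rw [measureReal_eq_zero_iff hbdd.measure_lt_top.ne] at h2
  exact (hopen.measure_pos volume hne).ne' h2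

theorem exists_poincare_constant (hopen : IsOpen ω) (hbdd : Bornology.IsBounded ω)
    (hnull : volume (frontier ω) = 0) (hN : 0 < N) :
    ∃ C : ℝ, 0 ≤ C ∧ ∀ (p : GraphSpace ω) (c : ℂ), HasBoundaryValue p c →
      ‖p.fst - c • oneLp ω‖ ≤ C * ‖p.snd‖ := by
  obtain ⟨R, hR0, hR⟩ := hbdd.subset_closedBall_lt 0 (0 : Euc N)
  exact ⟨2 * R, by positivity, fun p c h => h.norm_sub_le hopen hnull hR0.le hR ⟨0, hN⟩⟩

/-- By linearity the zero pair has boundary value `c - d`, and Poincaré forces that constant to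
vanish on `ω`. -/
theorem HasBoundaryValue.unique (hopen : IsOpen ω) (hbdd : Bornology.IsBounded ω)
    (hne : ω.Nonempty) (hnull : volume (frontier ω) = 0) (hN : 0 < N) {p : GraphSpace ω}
    {c d : ℂ} (hc : HasBoundaryValue p c) (hd : HasBoundaryValue p d) : c = d := by
  obtain ⟨C, -, key⟩ := exists_poincare_constant hopen hbdd hnull hN
  have h0 : HasBoundaryValue (0 : GraphSpace ω) (c + -1 * d) := by
    have := hc.add (hd.smul (-1))
    rwa [neg_one_smul, add_neg_cancel] at this
  have h1 := key _ _ h0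
  rw [WithLp.zero_fst, WithLp.zero_snd, zero_sub, norm_neg, norm_zero, mul_zero, norm_le_zero_iff,
    smul_eq_zero] at h1
  have h4 := h1.resolve_right (oneLp_ne_zero hopen hbdd hne)
  linear_combination h4

/-- Poincaré and the triangle inequality bound the boundary value by the graph norm; this is the
continuity of the functional. -/
theorem norm_mul_oneLp_le {C : ℝ} (hC : 0 ≤ C) (p : H1c ω) (c : ℂ)
    (h : ‖valL ω p - c • oneLp ω‖ ≤ C * ‖gradL ω p‖) :
    ‖c‖ * ‖oneLp ω‖ ≤ (1 + C) * ‖p‖ := by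
  have h1 : ‖valL ω p‖ ≤ ‖p‖ := by
    refine le_of_sq_le_sq ?_ (norm_nonneg _)
    rw [norm_sq_h1c p]
    linarith [sq_nonneg ‖gradL ω p‖]
  have h2 : ‖gradL ω p‖ ≤ ‖p‖ := by
    refine le_of_sq_le_sq ?_ (norm_nonneg _)
    rw [norm_sq_h1c p]
    linarith [sq_nonneg ‖valL ω p‖]
  have h5 : C * ‖gradL ω p‖ ≤ C * ‖p‖ := by gcongr
  have h6 := norm_sub_norm_le (c • oneLp ω) (valL ω p)
  rw [norm_sub_rev, norm_smul] at h6
  linarith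

/-- In dimension zero the complement of `ω` is empty and the weak identities are vacuous, so every
constant is a boundary value. A functional must be chosen: the coefficient of the projection onto
constants, which makes the Poincaré inequality hold with constant zero. -/
theorem exists_boundaryFunctional_dim_zero {ω : Set (Euc 0)}
    [IsFiniteMeasure (volume.restrict ω)] (hopen : IsOpen ω) (hbdd : Bornology.IsBounded ω)
    (hne : ω.Nonempty) :
    ∃ (b : H1c ω →L[ℂ] ℂ) (C : ℝ), ∀ p : H1c ω, HasBoundaryValue (p : GraphSpace ω) (b p) ∧
      ‖valL ω p - b p • oneLp ω‖ ≤ C * ‖gradL ω p‖ := by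
  have hone := oneLp_ne_zero hopen hbdd hne
  let b : H1c ω →L[ℂ] ℂ := ((‖oneLp ω‖ ^ 2 : ℝ) : ℂ)⁻¹ • (innerSL ℂ (oneLp ω) ∘L valL ω)
  refine ⟨b, 0, fun p => ⟨?_, ?_⟩⟩
  · refine hasBoundaryValue_of_isH1loc hopen ((isH1loc_indicator_iff hopen hbdd).2 ?_)
    exact fun ψ _ k => k.elim0
  · obtain ⟨c, h1⟩ : ∃ c : ℂ, valL ω p = c • oneLp ω := by
      refine ⟨valL ω p (0 : Euc 0), Lp.ext ?_⟩
      filter_upwards [coeFn_smul_oneLp (ω := ω) (valL ω p (0 : Euc 0))] with y hy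
      rw [hy, Subsingleton.elim y 0]
    have hn : ((‖oneLp ω‖ ^ 2 : ℝ) : ℂ) ≠ 0 := by
      simpa using hone
    have h3 : ⟪oneLp ω, oneLp ω⟫_ℂ = ((‖oneLp ω‖ ^ 2 : ℝ) : ℂ) := by
      rw [inner_self_eq_norm_sq_to_K]
      norm_cast
    have h2 : b p = c := by
      change ((‖oneLp ω‖ ^ 2 : ℝ) : ℂ)⁻¹ • ⟪oneLp ω, valL ω p⟫_ℂ = _
      rw [h1, inner_smul_right, h3, smul_eq_mul, mul_comm, mul_assoc,
        mul_inv_cancel₀ hn, mul_one]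
    rw [h2, h1, sub_self, norm_zero, zero_mul]

theorem exists_boundaryFunctional_dim_pos (hopen : IsOpen ω) (hbdd : Bornology.IsBounded ω)
    (hne : ω.Nonempty) (hnull : volume (frontier ω) = 0) (hN : 0 < N) :
    ∃ (b : H1c ω →L[ℂ] ℂ) (C : ℝ), (∀ p : H1c ω, HasBoundaryValue (p : GraphSpace ω) (b p) ∧
      ‖valL ω p - b p • oneLp ω‖ ≤ C * ‖gradL ω p‖) ∧
      ∀ (p : H1c ω) (c : ℂ), HasBoundaryValue (p : GraphSpace ω) c → c = b p := by
  have hone := oneLp_ne_zero hopen hbdd hne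
  obtain ⟨C, hC, key⟩ := exists_poincare_constant hopen hbdd hnull hN
  choose b hb using fun p : H1c ω => p.2
  have huniq : ∀ {p : GraphSpace ω} {c d : ℂ}, HasBoundaryValue p c → HasBoundaryValue p d →
      c = d := fun hc hd => hc.unique hopen hbdd hne hnull hN hd
  have hadd : ∀ p q, b (p + q) = b p + b q := fun p q =>
    huniq (hb (p + q)) ((hb p).add (hb q))
  have hsmul : ∀ (a : ℂ) p, b (a • p) = a * b p := fun a p =>
    huniq (hb (a • p)) ((hb p).smul a)
  let bl : H1c ω →ₗ[ℂ] ℂ := { toFun := b, map_add' := hadd, map_smul' := hsmul }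
  have hbound : ∀ p, ‖bl p‖ ≤ ‖oneLp ω‖⁻¹ * (1 + C) * ‖p‖ := by
    intro p
    rw [mul_assoc, ← div_eq_inv_mul, le_div_iff₀ (norm_pos_iff.2 hone)]
    exact norm_mul_oneLp_le hC p _ (key _ _ (hb p))
  exact ⟨bl.mkContinuous _ hbound, C, fun p => ⟨hb p, key _ _ (hb p)⟩,
    fun p c hc => huniq hc (hb p)⟩

/-- The boundary value is a bounded linear functional controlled by a Poincaré inequality. -/
theorem exists_boundaryFunctional (hopen : IsOpen ω) (hbdd : Bornology.IsBounded ω)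
    (hne : ω.Nonempty) (hnull : volume (frontier ω) = 0) :
    ∃ (b : H1c ω →L[ℂ] ℂ) (C : ℝ), (∀ p : H1c ω, HasBoundaryValue (p : GraphSpace ω) (b p) ∧
      ‖valL ω p - b p • oneLp ω‖ ≤ C * ‖gradL ω p‖) ∧
      (0 < N → ∀ (p : H1c ω) (c : ℂ), HasBoundaryValue (p : GraphSpace ω) c → c = b p) := by
  rcases Nat.eq_zero_or_pos N with rfl | hN
  · obtain ⟨b, C, h⟩ := exists_boundaryFunctional_dim_zero hopen hbdd hne
    exact ⟨b, C, h, fun h => absurd h (lt_irrefl 0)⟩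
  · obtain ⟨b, C, h, h'⟩ := exists_boundaryFunctional_dim_pos hopen hbdd hne hnull hN
    exact ⟨b, C, h, fun _ => h'⟩

/-- Weak identities with a fixed test function pass to the limit in the graph norm. -/
theorem isClosed_h1c (hopen : IsOpen ω) (hbdd : Bornology.IsBounded ω)
    (hne : ω.Nonempty) (hnull : volume (frontier ω) = 0) :
    IsClosed (H1c ω : Set (GraphSpace ω)) := by
  obtain ⟨b, C, hb, -⟩ := exists_boundaryFunctional hopen hbdd hne hnull
  refine isClosed_of_closure_subset fun p hp => ?_
  obtain ⟨x, hx, hlim⟩ := mem_closure_iff_seq_limit.1 hp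
  let y : ℕ → H1c ω := fun n => ⟨x n, hx n⟩
  have hy : CauchySeq y := by
    have h1 : CauchySeq x := hlim.cauchySeq
    rw [Metric.cauchySeq_iff] at h1 ⊢
    exact h1
  -- Continuity of `b` makes the boundary values converge, which supplies the candidate for the
  -- limit.
  obtain ⟨c, hc⟩ := cauchySeq_tendsto_of_complete (b.uniformContinuous.comp_cauchySeq hy)
  refine ⟨c, hasBoundaryValue_of_isH1loc hopen ((isH1loc_indicator_iff hopen hbdd).2 ?_)⟩
  intro ψ hψ k
  have hd : MemLp (fun x => ((fderiv ℝ ψ x (stdVec k) : ℝ) : ℂ)) 2 (volume.restrict ω) :=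
    ((hψ.memLp_fderiv (stdVec k)).restrict ω).ofReal
  have hψ2 : MemLp (fun x => ((ψ x : ℝ) : ℂ)) 2 (volume.restrict ω) :=
    ((hψ.1.continuous.memLp_of_hasCompactSupport hψ.2).restrict ω).ofReal
  have e1 : ∀ (q : GraphSpace ω) (c : ℂ),
      ∫ x in ω, (fderiv ℝ ψ x (stdVec k)) • (q.fst x - c) =
        ⟪hd.toLp, q.fst - c • oneLp ω⟫_ℂ := by
    intro q c
    rw [L2.inner_def]
    refine integral_congr_ae ?_
    filter_upwards [hd.coeFn_toLp, Lp.coeFn_sub q.fst (c • oneLp ω),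
      coeFn_smul_oneLp (ω := ω) c] with x h1 h2 h3
    rw [h1, h2, Pi.sub_apply, h3, RCLike.inner_apply, Complex.conj_ofReal, Complex.real_smul,
      mul_comm]
  have e2 : ∀ q : GraphSpace ω, ∫ x in ω, ψ x • q.snd x k =
      ⟪embedL ω k hψ2.toLp, q.snd⟫_ℂ := by
    intro q
    rw [L2.inner_def]
    refine integral_congr_ae ?_
    filter_upwards [hψ2.coeFn_toLp, coeFn_embedL k hψ2.toLp] with x h1 h2
    rw [h2, h1, EuclideanSpace.inner_single_left, Complex.conj_ofReal, Complex.real_smul]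
  have hz : ∀ n, ⟪hd.toLp, (x n).fst - b (y n) • oneLp ω⟫_ℂ +
      ⟪embedL ω k hψ2.toLp, (x n).snd⟫_ℂ = 0 := by
    intro n
    rw [← e1, ← e2, ← eq_neg_iff_add_eq_zero]
    exact (isH1loc_indicator_iff hopen hbdd).1 ((hb (y n)).1.isH1loc hopen hnull) ψ hψ k
  rw [e1, e2, eq_neg_iff_add_eq_zero]
  have hf : Tendsto (fun n => (x n).fst) atTop (𝓝 p.fst) :=
    ((WithLp.fstL 2 ℂ (Lp ℂ 2 (volume.restrict ω))
      (Lp (EuclideanSpace ℂ (Fin N)) 2 (volume.restrict ω))).continuous.tendsto p).comp hlim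
  have hs : Tendsto (fun n => (x n).snd) atTop (𝓝 p.snd) :=
    ((WithLp.sndL 2 ℂ (Lp ℂ 2 (volume.restrict ω))
      (Lp (EuclideanSpace ℂ (Fin N)) 2 (volume.restrict ω))).continuous.tendsto p).comp hlim
  have ht := (tendsto_const_nhds (x := hd.toLp)).inner (𝕜 := ℂ)
    (hf.sub (hc.smul_const (oneLp ω))) |>.add
    ((tendsto_const_nhds (x := embedL ω k hψ2.toLp)).inner (𝕜 := ℂ) hs)
  refine tendsto_nhds_unique ht ?_
  simp only [Function.comp_apply, hz]
  exact tendsto_const_nhds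

end TraceFunctional

/-! ### The coefficient matrix as a self-adjoint elliptic operator on complex fields -/

section Coefficient

variable {N : ℕ}

/-- The complexification of a real matrix, acting on complex vectors. -/
noncomputable def cmul (B : Matrix (Fin N) (Fin N) ℝ) (v : EuclideanSpace ℂ (Fin N)) :
    EuclideanSpace ℂ (Fin N) :=
  WithLp.toLp 2 fun k => ∑ l, (B k l : ℂ) * v l

theorem cmul_apply (B : Matrix (Fin N) (Fin N) ℝ) (v : EuclideanSpace ℂ (Fin N)) (k : Fin N) :
    cmul B v k = ∑ l, (B k l : ℂ) * v l := rfl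

theorem cmul_add (B : Matrix (Fin N) (Fin N) ℝ) (u v : EuclideanSpace ℂ (Fin N)) :
    cmul B (u + v) = cmul B u + cmul B v := by
  ext k
  simp [cmul_apply, mul_add, Finset.sum_add_distrib]

theorem cmul_smul (B : Matrix (Fin N) (Fin N) ℝ) (a : ℂ) (v : EuclideanSpace ℂ (Fin N)) :
    cmul B (a • v) = a • cmul B v := by
  ext k
  simp only [cmul_apply, PiLp.smul_apply, smul_eq_mul, Finset.mul_sum]
  exact Finset.sum_congr rfl fun l _ => by ring

/-- Componentwise real part. -/
noncomputable def reVec (v : EuclideanSpace ℂ (Fin N)) : Euc N := WithLp.toLp 2 fun k => (v k).re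

/-- Componentwise imaginary part. -/
noncomputable def imVec (v : EuclideanSpace ℂ (Fin N)) : Euc N := WithLp.toLp 2 fun k => (v k).im

theorem norm_sq_eq_re_im (v : EuclideanSpace ℂ (Fin N)) :
    ‖v‖ ^ 2 = ‖reVec v‖ ^ 2 + ‖imVec v‖ ^ 2 := by
  simp only [EuclideanSpace.norm_sq_eq, ← Finset.sum_add_distrib]
  refine Finset.sum_congr rfl fun k _ => ?_
  rw [Complex.sq_norm, Complex.normSq_apply]
  simp [reVec, imVec, sq]

theorem reVec_cmul (B : Matrix (Fin N) (Fin N) ℝ) (v : EuclideanSpace ℂ (Fin N)) :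
    reVec (cmul B v) = B.toEuclideanLin (reVec v) := by
  ext k
  rw [toEuclideanLin_coord]
  simp [reVec, cmul_apply]

theorem imVec_cmul (B : Matrix (Fin N) (Fin N) ℝ) (v : EuclideanSpace ℂ (Fin N)) :
    imVec (cmul B v) = B.toEuclideanLin (imVec v) := by
  ext k
  rw [toEuclideanLin_coord]
  simp [imVec, cmul_apply]

theorem norm_cmul_le {B : Matrix (Fin N) (Fin N) ℝ} {β : ℝ} (hβ : 0 ≤ β)
    (h : ∀ ξ : Euc N, ‖B.toEuclideanLin ξ‖ ≤ β * ‖ξ‖) (v : EuclideanSpace ℂ (Fin N)) :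
    ‖cmul B v‖ ≤ β * ‖v‖ := by
  refine le_of_sq_le_sq ?_ (by positivity)
  rw [mul_pow, norm_sq_eq_re_im, norm_sq_eq_re_im v, reVec_cmul, imVec_cmul, mul_add,
    ← mul_pow, ← mul_pow]
  gcongr
  · exact h _
  · exact h _

theorem re_inner_eq (u v : EuclideanSpace ℂ (Fin N)) :
    (⟪u, v⟫_ℂ).re = ⟪reVec u, reVec v⟫_ℝ + ⟪imVec u, imVec v⟫_ℝ := by
  simp only [PiLp.inner_apply, Complex.re_sum, ← Finset.sum_add_distrib]
  refine Finset.sum_congr rfl fun k _ => ?_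
  simp [reVec, imVec]

/-- A real matrix acts separately on real and imaginary parts, so the real bound is applied twice.
-/
theorem le_re_inner_cmul {B : Matrix (Fin N) (Fin N) ℝ} {α : ℝ}
    (h : ∀ ξ : Euc N, α * ‖ξ‖ ^ 2 ≤ ⟪B.toEuclideanLin ξ, ξ⟫_ℝ)
    (v : EuclideanSpace ℂ (Fin N)) : α * ‖v‖ ^ 2 ≤ (⟪v, cmul B v⟫_ℂ).re := by
  rw [re_inner_eq, reVec_cmul, imVec_cmul, norm_sq_eq_re_im, mul_add,
    real_inner_comm, real_inner_comm (B.toEuclideanLin (imVec v))]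
  exact add_le_add (h _) (h _)

theorem inner_cmul (B : Matrix (Fin N) (Fin N) ℝ) (u v : EuclideanSpace ℂ (Fin N)) :
    ⟪u, cmul B v⟫_ℂ = ∑ k, ∑ l, (B k l : ℂ) * v l * (starRingEnd ℂ) (u k) := by
  simp only [PiLp.inner_apply, RCLike.inner_apply, cmul_apply, Finset.sum_mul]

theorem inner_cmul_symm {B : Matrix (Fin N) (Fin N) ℝ} (h : ∀ k l, B k l = B l k)
    (u v : EuclideanSpace ℂ (Fin N)) : ⟪cmul B u, v⟫_ℂ = ⟪u, cmul B v⟫_ℂ := by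
  rw [← inner_conj_symm, inner_cmul, inner_cmul, map_sum, Finset.sum_comm]
  simp only [map_sum, map_mul, Complex.conj_ofReal, Complex.conj_conj]
  rw [Finset.sum_comm]
  refine (Finset.sum_comm).trans (Finset.sum_congr rfl fun k _ => Finset.sum_congr rfl fun l _ => ?_)
  rw [h l k]
  ring

variable {ω : Set (Euc N)} {α β : ℝ} {A : Euc N → Matrix (Fin N) (Fin N) ℝ}

theorem IsCoefficient.norm_cmul_ae (hA : IsCoefficient α β ω A) (hβ : 0 ≤ β)
    (u : Lp (EuclideanSpace ℂ (Fin N)) 2 (volume.restrict ω)) :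
    ∀ᵐ y ∂volume.restrict ω, ‖cmul (A y) (u y)‖ ≤ β * ‖u y‖ := by
  filter_upwards [hA.upper] with y hy using norm_cmul_le hβ hy _

theorem IsCoefficient.memLp_cmul (hA : IsCoefficient α β ω A)
    (u : Lp (EuclideanSpace ℂ (Fin N)) 2 (volume.restrict ω)) :
    MemLp (fun y => cmul (A y) (u y)) 2 (volume.restrict ω) := by
  refine MemLp.of_eval_piLp fun k => ?_
  simp only [cmul_apply]
  refine memLp_finsetSum _ fun l _ => ?_
  have hl := (Lp.memLp u).eval_piLp l
  refine hl.of_le_mul (c := β)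
    ((Complex.continuous_ofReal.comp_aestronglyMeasurable (hA.measurable k l)).mul hl.1) ?_
  filter_upwards [hA.entry_le] with y hy
  rw [norm_mul, Complex.norm_real]
  gcongr
  exact hy k l

/-- Multiplication of vector fields by the coefficient matrix. -/
noncomputable def IsCoefficient.coeffL (hA : IsCoefficient α β ω A) (hβ : 0 ≤ β) :
    Lp (EuclideanSpace ℂ (Fin N)) 2 (volume.restrict ω) →L[ℂ]
      Lp (EuclideanSpace ℂ (Fin N)) 2 (volume.restrict ω) :=
  LinearMap.mkContinuous
    { toFun := fun u => (hA.memLp_cmul u).toLp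
      map_add' := fun u v => by
        refine Lp.ext ?_
        filter_upwards [(hA.memLp_cmul (u + v)).coeFn_toLp, (hA.memLp_cmul u).coeFn_toLp,
          (hA.memLp_cmul v).coeFn_toLp, Lp.coeFn_add u v,
          Lp.coeFn_add (hA.memLp_cmul u).toLp (hA.memLp_cmul v).toLp] with y h1 h2 h3 h4 h5
        rw [h1, h5, Pi.add_apply, h2, h3, h4, Pi.add_apply, cmul_add]
      map_smul' := fun a u => by
        refine Lp.ext ?_
        filter_upwards [(hA.memLp_cmul (a • u)).coeFn_toLp, (hA.memLp_cmul u).coeFn_toLp,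
          Lp.coeFn_smul a u, Lp.coeFn_smul a (hA.memLp_cmul u).toLp] with y h1 h2 h3 h4
        rw [h1, RingHom.id_apply, h4, Pi.smul_apply, h2, h3, Pi.smul_apply, cmul_smul] }
    β fun u => by
      refine Lp.norm_le_mul_norm_of_ae_le_mul ?_
      filter_upwards [hA.norm_cmul_ae hβ u, (hA.memLp_cmul u).coeFn_toLp] with y h1 h2
      change ‖(hA.memLp_cmul u).toLp _ y‖ ≤ _
      rw [h2]
      exact h1

theorem IsCoefficient.coeFn_coeffL (hA : IsCoefficient α β ω A) (hβ : 0 ≤ β)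
    (u : Lp (EuclideanSpace ℂ (Fin N)) 2 (volume.restrict ω)) :
    ∀ᵐ y ∂volume.restrict ω, hA.coeffL hβ u y = cmul (A y) (u y) :=
  (hA.memLp_cmul u).coeFn_toLp

theorem IsCoefficient.inner_coeffL (hA : IsCoefficient α β ω A) (hβ : 0 ≤ β)
    (u v : Lp (EuclideanSpace ℂ (Fin N)) 2 (volume.restrict ω)) :
    ⟪u, hA.coeffL hβ v⟫_ℂ = ∫ y in ω, ⟪u y, cmul (A y) (v y)⟫_ℂ := by
  rw [L2.inner_def]
  refine integral_congr_ae ?_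
  filter_upwards [hA.coeFn_coeffL hβ v] with y hy
  rw [hy]

theorem IsCoefficient.coeffL_symm (hA : IsCoefficient α β ω A) (hβ : 0 ≤ β)
    (u v : Lp (EuclideanSpace ℂ (Fin N)) 2 (volume.restrict ω)) :
    ⟪hA.coeffL hβ u, v⟫_ℂ = ⟪u, hA.coeffL hβ v⟫_ℂ := by
  rw [hA.inner_coeffL, L2.inner_def]
  refine integral_congr_ae ?_
  filter_upwards [hA.coeFn_coeffL hβ u, hA.symm] with y hy hs
  rw [hy, inner_cmul_symm hs]

theorem IsCoefficient.le_re_inner_coeffL (hA : IsCoefficient α β ω A) (hβ : 0 ≤ β)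
    (u : Lp (EuclideanSpace ℂ (Fin N)) 2 (volume.restrict ω)) :
    α * ‖u‖ ^ 2 ≤ (⟪u, hA.coeffL hβ u⟫_ℂ).re := by
  have hi : Integrable (fun y => ⟪u y, hA.coeffL hβ u y⟫_ℂ) (volume.restrict ω) :=
    L2.integrable_inner u _
  have e : (⟪u, hA.coeffL hβ u⟫_ℂ).re = ∫ y in ω, (⟪u y, hA.coeffL hβ u y⟫_ℂ).re := by
    rw [L2.inner_def]
    exact (integral_re hi).symm
  rw [e, norm_sq_lp, ← integral_const_mul]
  refine integral_mono_ae ((Lp.memLp u).norm.integrable_sq.const_mul _) hi.re ?_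
  filter_upwards [hA.coeFn_coeffL hβ u, hA.lower] with y hy hl
  rw [hy]
  exact le_re_inner_cmul hl _

end Coefficient

/-! ### Symmetry of the flux pairing and uniqueness of the first derivative -/

section FluxSymmetry

set_option linter.unusedSectionVars false

variable {H K₀ K₁ : Type*} {N : ℕ}
  [NormedAddCommGroup H] [InnerProductSpace ℂ H] [CompleteSpace H]
  [NormedAddCommGroup K₀] [InnerProductSpace ℂ K₀] [CompleteSpace K₀]
  [NormedAddCommGroup K₁] [InnerProductSpace ℂ K₁] [CompleteSpace K₁]
  {D : ShiftedFormData N H K₀ K₁} {lam : Euc N → ℝ} {φ : Euc N → H}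

namespace ShiftedFormData

/-- By the first-order equation a gradient may be added on the test side at no cost, which turns the
pairing into the symmetric energy of two corrected fields. -/
theorem IsBranch.fluxPair_symm (h : D.IsBranch lam φ) (k l : Fin N) :
    D.fluxPair k (D.grad (fderiv ℝ φ 0 (stdVec l)) + D.shift l D.one) =
      D.fluxPair l (D.grad (fderiv ℝ φ 0 (stdVec k)) + D.shift k D.one) := by
  have e : ∀ k l, D.fluxPair k (D.grad (fderiv ℝ φ 0 (stdVec l)) + D.shift l D.one) =
      (⟪D.grad (fderiv ℝ φ 0 (stdVec k)) + D.shift k D.one,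
        D.coeff (D.grad (fderiv ℝ φ 0 (stdVec l)) + D.shift l D.one)⟫_ℂ).re := by
    intro k l
    rw [inner_add_left, h.inner_coeff_fderiv, zero_add, fluxPair_apply]
  rw [e, e, ← D.coeff_symm, ← inner_conj_symm, Complex.conj_re]

/-- The first derivative of the eigenvector is characterized by its weak equation. -/
theorem IsBranch.fderiv_eq (h : D.IsBranch lam φ) (k : Fin N) {q : H} (hq : D.bv q = 0)
    (hw : ∀ ψ, ⟪D.grad ψ, D.coeff (D.grad q + D.shift k D.one)⟫_ℂ = 0) :
    fderiv ℝ φ 0 (stdVec k) = q := by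
  -- The difference of two solutions has zero energy and zero boundary value, so ellipticity and
  -- Poincaré make it vanish.
  set d := fderiv ℝ φ 0 (stdVec k) - q with hd
  have h1 : ⟪D.grad d, D.coeff (D.grad d)⟫_ℂ = 0 := by
    have e : D.grad d = (D.grad (fderiv ℝ φ 0 (stdVec k)) + D.shift k D.one) -
        (D.grad q + D.shift k D.one) := by
      rw [hd, map_sub]; abel
    conv_lhs => rw [e]
    rw [map_sub, ← e, inner_sub_right, h.inner_coeff_fderiv, hw, sub_zero]
  have h2 := D.coeff_lower (D.grad d)
  rw [h1, Complex.zero_re] at h2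
  have h3 : ‖D.grad d‖ ^ 2 ≤ 0 := nonpos_of_mul_nonpos_right h2 D.ellip_pos
  have h4 : D.grad d = 0 := by simpa using le_antisymm h3 (sq_nonneg _)
  have h5 : D.bv d = 0 := by rw [hd, map_sub, h.bv_fderiv, hq, sub_zero]
  have h6 := D.poincare d
  rw [h5, h4, norm_zero, mul_zero, zero_smul, sub_zero, norm_le_zero_iff] at h6
  have h7 := D.norm_sq d
  rw [h4, h6] at h7
  have h8 : d = 0 := by simpa using h7
  exact sub_eq_zero.1 h8

end ShiftedFormData

end FluxSymmetry

/-! ### The Bloch form as an instance of the abstract data -/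

section BlochData

variable {N : ℕ} {ω : Set (Euc N)} {α β : ℝ} {A : Euc N → Matrix (Fin N) (Fin N) ℝ}

theorem integral_val_mul_conj (φ ψ : H1c ω) :
    ∫ y in ω, h1Val φ y * (starRingEnd ℂ) (h1Val ψ y) = ⟪valL ω ψ, valL ω φ⟫_ℂ := by
  rw [L2.inner_def]
  rfl

variable [IsFiniteMeasure (volume.restrict ω)]

/-- The constant function one as an element of `H¹_c(ω)`. -/
noncomputable def oneH1c (ω : Set (Euc N)) [IsFiniteMeasure (volume.restrict ω)] : H1c ω :=
  ⟨WithLp.toLp 2 (oneLp ω, 0), 1, hasBoundaryValue_one⟩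

theorem valL_oneH1c : valL ω (oneH1c ω) = oneLp ω := rfl

theorem gradL_oneH1c : gradL ω (oneH1c ω) = 0 := rfl

/-- A boundary value functional on `H¹_c(ω)` together with a Poincaré constant. -/
structure IsTraceWith (b : H1c ω →L[ℂ] ℂ) (C : ℝ) : Prop where
  hasBoundaryValue : ∀ p : H1c ω, HasBoundaryValue (p : GraphSpace ω) (b p)
  poincare : ∀ p : H1c ω, ‖valL ω p - b p • oneLp ω‖ ≤ C * ‖gradL ω p‖
  unique : 0 < N → ∀ (p : H1c ω) (c : ℂ), HasBoundaryValue (p : GraphSpace ω) c → c = b p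

theorem IsTraceWith.map_one {b : H1c ω →L[ℂ] ℂ} {C : ℝ} (h : IsTraceWith b C)
    (hone : oneLp ω ≠ 0) : b (oneH1c ω) = 1 := by
  have h1 := h.poincare (oneH1c ω)
  rw [gradL_oneH1c, norm_zero, mul_zero, norm_le_zero_iff, valL_oneH1c] at h1
  have h2 : (1 - b (oneH1c ω)) • oneLp ω = 0 := by rw [sub_smul, one_smul, h1]
  exact (sub_eq_zero.1 ((smul_eq_zero.1 h2).resolve_right hone)).symm

/-- The Bloch form on `H¹_c(ω)` as an instance of the abstract data. -/
noncomputable def blochData (hA : IsCoefficient α β ω A) (hα : 0 < α) (hβ : 0 ≤ β)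
    {b : H1c ω →L[ℂ] ℂ} {C : ℝ} (h : IsTraceWith b C) (hone : oneLp ω ≠ 0) :
    ShiftedFormData N (H1c ω) (Lp ℂ 2 (volume.restrict ω))
      (Lp (EuclideanSpace ℂ (Fin N)) 2 (volume.restrict ω)) where
  val := valL ω
  grad := gradL ω
  coeff := hA.coeffL hβ
  embed := embedL ω
  bv := b
  one := oneH1c ω
  ellip := α
  poin := C
  ellip_pos := hα
  coeff_symm := hA.coeffL_symm hβ
  coeff_lower := hA.le_re_inner_coeffL hβ
  norm_sq := norm_sq_h1c
  poincare φ := by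
    rw [map_sub, map_smul, valL_oneH1c]
    exact h.poincare φ
  grad_one := gradL_oneH1c
  bv_one := h.map_one hone
  val_one := hone

section

variable (hA : IsCoefficient α β ω A) (hα : 0 < α) (hβ : 0 ≤ β)
  {b : H1c ω →L[ℂ] ℂ} {C : ℝ} (h : IsTraceWith b C) (hone : oneLp ω ≠ 0)

theorem coeFn_shift (k : Fin N) (φ : H1c ω) : ∀ᵐ y ∂volume.restrict ω,
    (blochData hA hα hβ h hone).shift k φ y = Complex.I • EuclideanSpace.single k (h1Val φ y) := by
  filter_upwards [Lp.coeFn_smul Complex.I (embedL ω k (valL ω φ)),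
    coeFn_embedL k (valL ω φ)] with y h1 h2
  refine h1.trans ?_
  rw [Pi.smul_apply, h2]
  rfl

theorem coeFn_sgrad (η : Euc N) (φ : H1c ω) : ∀ᵐ y ∂volume.restrict ω, ∀ l,
    (blochData hA hα hβ h hone).sgrad η φ y l =
      h1Grad φ y l + Complex.I * (η l : ℂ) * h1Val φ y := by
  set D := blochData hA hα hβ h hone
  have e : D.sgrad η φ = gradL ω φ + ∑ k, ((η k : ℝ) : ℂ) • D.shift k φ := by
    simp only [ShiftedFormData.sgrad, add_apply, sum_apply, smul_apply]
    rfl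
  rw [e]
  filter_upwards [Lp.coeFn_add (gradL ω φ) (∑ k, ((η k : ℝ) : ℂ) • D.shift k φ),
    Lp.coeFn_fun_finsetSum Finset.univ fun k => ((η k : ℝ) : ℂ) • D.shift k φ,
    ae_all_iff.2 fun k => Lp.coeFn_smul ((η k : ℝ) : ℂ) (D.shift k φ),
    ae_all_iff.2 fun k => coeFn_shift hA hα hβ h hone k φ] with y h1 h2 h3 h4 l
  rw [h1, Pi.add_apply, h2]
  simp only [h3, Pi.smul_apply, D, h4]
  rw [PiLp.add_apply]
  congr 1
  simp [Pi.single_apply]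
  ring

theorem shiftedForm_eq (η : Euc N) (φ ψ : H1c ω) :
    shiftedForm A η φ ψ = (blochData hA hα hβ h hone).form η φ ψ := by
  refine Eq.trans ?_ (hA.inner_coeffL hβ _ _).symm
  refine integral_congr_ae ?_
  filter_upwards [coeFn_sgrad hA hα hβ h hone η φ, coeFn_sgrad hA hα hβ h hone η ψ] with y h1 h2
  rw [inner_cmul]
  simp only [h1, h2]

theorem isBlochEigenpair_iff (η : Euc N) (μ : ℝ) (φ : H1c ω) :
    IsBlochEigenpair A η (μ : ℂ) φ ↔ φ ≠ 0 ∧ (blochData hA hα hβ h hone).IsEigen η μ φ := by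
  unfold IsBlochEigenpair ShiftedFormData.IsEigen
  simp only [shiftedForm_eq hA hα hβ h hone, integral_val_mul_conj]
  rfl

end

end BlochData

/-! ### Identification of the first derivative with the corrector -/

section Corrector

variable {N : ℕ} {ω : Set (Euc N)} {α β : ℝ} {A : Euc N → Matrix (Fin N) (Fin N) ℝ}
  {M : Matrix (Fin N) (Fin N) ℝ} {ξ : Euc N} {w : Euc N → ℝ} {G : Euc N → Euc N}

/-- The field `u = i ∇w_ξ` has flux `i A ∇w_ξ` with `A ∇w_ξ` real, so the pairing is `i` times the
conjugate of an integral already known to vanish. -/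
theorem IsCellPair.inner_gradL_coeffL (hopen : IsOpen ω) (hbdd : Bornology.IsBounded ω)
    (hnull : volume (frontier ω) = 0) (hA : IsCoefficient α β ω A) (hβ : 0 ≤ β)
    (hw : IsCellPair ω A M ξ w G)
    {u : Lp (EuclideanSpace ℂ (Fin N)) 2 (volume.restrict ω)}
    (hu : ∀ᵐ y ∂volume.restrict ω, ∀ l, u y l = Complex.I * ((G y l : ℝ) : ℂ)) (ψ : H1c ω) :
    ⟪gradL ω ψ, hA.coeffL hβ u⟫_ℂ = 0 := by
  rw [hA.inner_coeffL]
  obtain ⟨c, hc⟩ := ψ.2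
  have h0 := hw.integral_flux_mul_snd hopen hbdd hnull hA hc
  have e : ∫ y in ω, ⟪gradL ω ψ y, cmul (A y) (u y)⟫_ℂ =
      ∫ y in ω, Complex.I * (starRingEnd ℂ)
        (∑ k, ((∑ l, A y k l * G y l : ℝ) : ℂ) * (ψ : GraphSpace ω).snd y k) := by
    refine integral_congr_ae ?_
    filter_upwards [hu] with y hy
    rw [inner_cmul, map_sum, Finset.mul_sum]
    refine Finset.sum_congr rfl fun k _ => ?_
    rw [map_mul, Complex.conj_ofReal, Complex.ofReal_sum, Finset.sum_mul, Finset.mul_sum]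
    refine Finset.sum_congr rfl fun l _ => ?_
    rw [hy, Complex.ofReal_mul, gradL_apply]
    ring
  rw [e, integral_const_mul, integral_conj, h0, map_zero, mul_zero]

/-- The two factors `i` cancel, one being conjugated, and the mean of the `j`-th flux component
remains. -/
theorem IsCellPair.inner_single_coeffL (hopen : IsOpen ω) (hbdd : Bornology.IsBounded ω)
    (hnull : volume (frontier ω) = 0) (hA : IsCoefficient α β ω A) (hβ : 0 ≤ β)
    (hw : IsCellPair ω A M ξ w G)
    {s u : Lp (EuclideanSpace ℂ (Fin N)) 2 (volume.restrict ω)} {j : Fin N}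
    (hs : ∀ᵐ y ∂volume.restrict ω, s y = Complex.I • EuclideanSpace.single j (1 : ℂ))
    (hu : ∀ᵐ y ∂volume.restrict ω, ∀ l, u y l = Complex.I * ((G y l : ℝ) : ℂ)) :
    ⟪s, hA.coeffL hβ u⟫_ℂ = ((volume.real ω * ∑ l, M j l * ξ l : ℝ) : ℂ) := by
  have e : ⟪s, hA.coeffL hβ u⟫_ℂ = ∫ y in ω, ((∑ l, A y j l * G y l : ℝ) : ℂ) := by
    rw [hA.inner_coeffL]
    refine integral_congr_ae ?_
    filter_upwards [hu, hs] with y h1 h2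
    rw [h2, inner_smul_left, EuclideanSpace.inner_single_left, cmul_apply]
    simp only [h1, map_one, one_mul, Complex.conj_I, Complex.ofReal_sum, Finset.mul_sum,
      Complex.ofReal_mul]
    refine Finset.sum_congr rfl fun l _ => ?_
    linear_combination (-(A y j l : ℂ) * (G y l : ℂ)) * Complex.I_mul_I
  rw [e, integral_complex_ofReal, hw.integral_flux hopen hbdd hnull hA]

/-- The corrector `i (w_{e_k} - y_k)` as an element of `H¹_c(ω)`. -/
theorem IsCellPair.exists_h1c_corrector (hbdd : Bornology.IsBounded ω) {k : Fin N}
    (hw : IsCellPair ω A M (stdVec k) w G) :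
    ∃ q : H1c ω, HasBoundaryValue (q : GraphSpace ω) 0 ∧
      (∀ᵐ y ∂volume.restrict ω, h1Val q y = Complex.I * ((w y - y k : ℝ) : ℂ)) ∧
      ∀ s : Lp (EuclideanSpace ℂ (Fin N)) 2 (volume.restrict ω),
        (∀ᵐ y ∂volume.restrict ω, s y = Complex.I • EuclideanSpace.single k (1 : ℂ)) →
        ∀ᵐ y ∂volume.restrict ω, ∀ l, (gradL ω q + s) y l = Complex.I * ((G y l : ℝ) : ℂ) := by
  obtain ⟨p, hp, hp1, hp2⟩ := hw.exists_corrector hbdd Complex.I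
  refine ⟨⟨p, 0, hp⟩, hp, ?_, fun s hs => ?_⟩
  · filter_upwards [hp1] with y hy
    have e : ⟪(stdVec k : Euc N), y⟫_ℝ = y k := by
      simp [EuclideanSpace.inner_single_left]
    rw [e] at hy
    exact hy
  · filter_upwards [hp2, Lp.coeFn_add p.snd s, hs] with y h1 h2 h3 l
    refine (congrArg (fun v : EuclideanSpace ℂ (Fin N) => v l) h2).trans ?_
    rw [Pi.add_apply, PiLp.add_apply, h1, h3]
    by_cases hl : l = k
    · subst hl
      simp
      ring
    · simp [hl]

variable [IsFiniteMeasure (volume.restrict ω)]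
  (hA : IsCoefficient α β ω A) (hα : 0 < α) (hβ : 0 ≤ β)
  {b : H1c ω →L[ℂ] ℂ} {C : ℝ} (h : IsTraceWith b C) (hone : oneLp ω ≠ 0)

theorem coeFn_shift_one (k : Fin N) : ∀ᵐ y ∂volume.restrict ω,
    (blochData hA hα hβ h hone).shift k (oneH1c ω) y =
      Complex.I • EuclideanSpace.single k (1 : ℂ) := by
  filter_upwards [coeFn_shift hA hα hβ h hone k (oneH1c ω), coeFn_smul_oneLp (ω := ω) 1]
    with y h1 h2
  have h3 : h1Val (oneH1c ω) y = 1 := by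
    rw [one_smul] at h2
    exact h2
  rw [h1, h3]

variable {lam : Euc N → ℝ} {φ : Euc N → H1c ω} [CompleteSpace (H1c ω)]

/-- The first derivative of the eigenvector is the corrector. -/
theorem IsCellPair.fderiv_vec (hopen : IsOpen ω) (hbdd : Bornology.IsBounded ω)
    (hnull : volume (frontier ω) = 0)
    (hφ : (blochData hA hα hβ h hone).IsBranch lam φ) {k : Fin N}
    (hw : IsCellPair ω A M (stdVec k) w G) :
    (∀ᵐ y ∂volume.restrict ω,
      h1Val (fderiv ℝ φ 0 (stdVec k)) y = Complex.I * ((w y - y k : ℝ) : ℂ)) ∧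
    ∀ j, (blochData hA hα hβ h hone).fluxPair j (gradL ω (fderiv ℝ φ 0 (stdVec k)) +
        (blochData hA hα hβ h hone).shift k (oneH1c ω)) = volume.real ω * M j k := by
  obtain ⟨q, hq0, hq1, hq2⟩ := hw.exists_h1c_corrector hbdd
  have hu := hq2 _ (coeFn_shift_one hA hα hβ h hone k)
  -- The index `k` itself shows that the dimension is positive, so boundary values are unique and `b
  -- q = 0`.
  have hfd : fderiv ℝ φ 0 (stdVec k) = q :=
    hφ.fderiv_eq k (h.unique (Fin.pos k) q 0 hq0).symm
      fun ψ => hw.inner_gradL_coeffL hopen hbdd hnull hA hβ hu ψ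
  rw [hfd]
  refine ⟨hq1, fun j => ?_⟩
  rw [ShiftedFormData.fluxPair_apply]
  have e := hw.inner_single_coeffL hopen hbdd hnull hA hβ
    (coeFn_shift_one hA hα hβ h hone j) hu
  refine (congrArg Complex.re e).trans ?_
  rw [Complex.ofReal_re]
  simp

end Corrector

/-! ### Abstract ground states near the origin -/

section AbstractGround

variable {H K₀ K₁ : Type*} {N : ℕ}
  [NormedAddCommGroup H] [InnerProductSpace ℂ H]
  [NormedAddCommGroup K₀] [InnerProductSpace ℂ K₀]
  [NormedAddCommGroup K₁] [InnerProductSpace ℂ K₁]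

namespace ShiftedFormData

theorem IsEigen.smul {D : ShiftedFormData N H K₀ K₁} {η : Euc N} {μ : ℝ} {φ : H}
    (h : D.IsEigen η μ φ) (a : ℂ) : D.IsEigen η μ (a • φ) := by
  intro ψ
  have := h ψ
  simp only [form, map_smul, inner_smul_right] at this ⊢
  rw [this]
  ring

/-- `lam η` is the lowest eigenvalue at `η`, simple, with eigenvector `φ η` normalized by
its boundary value. -/
structure IsGround (D : ShiftedFormData N H K₀ K₁) (η : Euc N) (μ₀ : ℝ) (φ₀ : H) : Prop where
  isEigen : D.IsEigen η μ₀ φ₀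
  bv_eq : D.bv φ₀ = 1
  least : ∀ μ ψ, μ ≤ μ₀ → D.IsEigen η μ ψ → ψ ≠ 0 → μ = μ₀ ∧ ψ = D.bv ψ • φ₀

theorem IsGround.ne_zero {D : ShiftedFormData N H K₀ K₁} {η : Euc N} {μ₀ : ℝ} {φ₀ : H}
    (h : D.IsGround η μ₀ φ₀) : φ₀ ≠ 0 := by
  intro h0
  have := h.bv_eq
  rw [h0, map_zero] at this
  exact zero_ne_one this

variable [CompleteSpace H] [CompleteSpace K₀] [CompleteSpace K₁]

/-- On a neighborhood of the origin there is an analytic branch of simple ground states. -/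
theorem exists_ground_branch (D : ShiftedFormData N H K₀ K₁) :
    ∃ (U : Set (Euc N)) (lam : Euc N → ℝ) (φ : Euc N → H), IsOpen U ∧ (0 : Euc N) ∈ U ∧
      D.IsBranch lam φ ∧ AnalyticOnNhd ℝ lam U ∧ AnalyticOnNhd ℝ φ U ∧
      ∀ η ∈ U, D.IsGround η (lam η) (φ η) := by
  obtain ⟨lam, φ, hlam, hφ, h0, h1, hev⟩ := D.exists_branch
  obtain ⟨U, hU, hUo, h0U⟩ := eventually_nhds_iff.1
    (hlam.eventually_analyticAt.and (hφ.eventually_analyticAt.and hev))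
  exact ⟨U, lam, φ, hUo, h0U,
    ⟨hlam, hφ, h0, h1, hev.mono fun η h => h.1, hev.mono fun η h => h.2.1⟩,
    fun η hη => (hU η hη).1, fun η hη => (hU η hη).2.1,
    fun η hη => ⟨(hU η hη).2.2.1, (hU η hη).2.2.2.1, (hU η hη).2.2.2.2⟩⟩

/-- The two flux pairings in the Hessian formula agree by symmetry, which accounts for the factor
one half. -/
theorem IsBranch.half_iteratedFDeriv {D : ShiftedFormData N H K₀ K₁} {lam : Euc N → ℝ}
    {φ : Euc N → H} (h : D.IsBranch lam φ) {v : ℝ} (hv : ‖D.val D.one‖ ^ 2 = v)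
    {M : Matrix (Fin N) (Fin N) ℝ}
    (hM : ∀ i j, D.fluxPair j (D.grad (fderiv ℝ φ 0 (stdVec i)) + D.shift i D.one) = v * M j i)
    (k l : Fin N) :
    (1 / 2 : ℝ) * iteratedFDeriv ℝ 2 lam 0 ![stdVec k, stdVec l] = M k l := by
  have hv0 : v ≠ 0 := by
    rw [← hv]
    exact pow_ne_zero 2 (norm_ne_zero_iff.2 D.val_one)
  have e1 := h.hessian k l
  have e2 := h.fluxPair_symm k l
  rw [hM, hM, hv] at e1
  rw [hM, hM] at e2
  refine mul_left_cancel₀ hv0 ?_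
  linear_combination (1 / 2 : ℝ) * e1 - (1 / 2 : ℝ) * e2

end ShiftedFormData

end AbstractGround

/-! ### Normalization by a constant factor -/

section Scaling

variable {N : ℕ} {ω : Set (Euc N)}

theorem coeFn_smul_h1c (a : ℂ) (φ : H1c ω) :
    ∀ᵐ y ∂volume.restrict ω, h1Val (a • φ) y = a * h1Val φ y :=
  Lp.coeFn_smul a (φ : GraphSpace ω).fst

theorem fderiv_smul_vec {φ : Euc N → H1c ω} (hφ : AnalyticAt ℝ φ 0) (a : ℂ) (v : Euc N) :
    fderiv ℝ (fun η => a • φ η) 0 v = a • fderiv ℝ φ 0 v := by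
  have := hφ.differentiableAt.hasFDerivAt.const_smul a
  exact congrArg (fun L : Euc N →L[ℝ] H1c ω => L v) this.fderiv

end Scaling

/-! ### Ground states of the Bloch problem -/

section Ground

variable {N : ℕ} {ω : Set (Euc N)} {α β : ℝ} {A : Euc N → Matrix (Fin N) (Fin N) ℝ}
  {M : Matrix (Fin N) (Fin N) ℝ} [IsFiniteMeasure (volume.restrict ω)]
  (hA : IsCoefficient α β ω A) (hα : 0 < α) (hβ : 0 ≤ β)
  {b : H1c ω →L[ℂ] ℂ} {C : ℝ} (h : IsTraceWith b C) (hone : oneLp ω ≠ 0)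

theorem isLeast_of_isGround {η : Euc N} {μ₀ : ℝ} {φ₀ : H1c ω}
    (hg : (blochData hA hα hβ h hone).IsGround η μ₀ φ₀) :
    IsLeast (blochEigenvalues ω A η) μ₀ := by
  refine ⟨⟨φ₀, (isBlochEigenpair_iff hA hα hβ h hone η μ₀ φ₀).2 ⟨hg.ne_zero, hg.isEigen⟩⟩, ?_⟩
  rintro μ ⟨ψ, hψ⟩
  obtain ⟨h1, h2⟩ := (isBlochEigenpair_iff hA hα hβ h hone η μ ψ).1 hψ
  by_contra! hlt
  exact hlt.ne (hg.least μ ψ hlt.le h2 h1).1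

theorem groundEnergy_eq_of_isGround {η : Euc N} {μ₀ : ℝ} {φ₀ : H1c ω}
    (hg : (blochData hA hα hβ h hone).IsGround η μ₀ φ₀) : groundEnergy ω A η = μ₀ :=
  (isLeast_of_isGround hA hα hβ h hone hg).csInf_eq

/-- Ground states rescaled to the boundary value `a`. -/
theorem isGround_spec {η : Euc N} {μ₀ : ℝ} {φ₀ : H1c ω} {a : ℂ} (ha : a ≠ 0)
    (hg : (blochData hA hα hβ h hone).IsGround η μ₀ φ₀) :
    IsLeast (blochEigenvalues ω A η) (groundEnergy ω A η) ∧
      IsBlochEigenpair A η (groundEnergy ω A η : ℂ) (a • φ₀) ∧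
      HasBoundaryValue ((a • φ₀ : H1c ω) : GraphSpace ω) a ∧
      ∀ ψ : H1c ω, IsBlochEigenpair A η (groundEnergy ω A η : ℂ) ψ → ∃ c : ℂ, ψ = c • a • φ₀ := by
  rw [groundEnergy_eq_of_isGround hA hα hβ h hone hg]
  refine ⟨isLeast_of_isGround hA hα hβ h hone hg,
    (isBlochEigenpair_iff hA hα hβ h hone η μ₀ _).2
      ⟨smul_ne_zero ha hg.ne_zero, hg.isEigen.smul a⟩, ?_, fun ψ hψ => ?_⟩
  · have h1 := h.hasBoundaryValue (a • φ₀)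
    have h2 : b φ₀ = 1 := hg.bv_eq
    rwa [map_smul, h2, smul_eq_mul, mul_one] at h1
  · obtain ⟨h1, h2⟩ := (isBlochEigenpair_iff hA hα hβ h hone η μ₀ ψ).1 hψ
    refine ⟨b ψ * a⁻¹, ?_⟩
    rw [smul_smul, inv_mul_cancel_right₀ ha]
    exact (hg.least μ₀ ψ le_rfl h2 h1).2

theorem normConst_ne_zero (hone : oneLp ω ≠ 0) : (normConst ω : ℂ) ≠ 0 := by
  refine Complex.ofReal_ne_zero.2 (Real.rpow_pos_of_pos ?_ _).ne'
  rw [← norm_sq_oneLp]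
  exact pow_pos (norm_pos_iff.2 hone) 2

theorem coeFn_smul_oneH1c (a : ℂ) :
    ∀ᵐ y ∂volume.restrict ω, h1Val (a • oneH1c ω) y = a :=
  coeFn_smul_oneLp a

variable {lam : Euc N → ℝ} {φ : Euc N → H1c ω} [CompleteSpace (H1c ω)]

theorem half_iteratedFDeriv_lam (hopen : IsOpen ω) (hbdd : Bornology.IsBounded ω)
    (hnull : volume (frontier ω) = 0)
    (hφ : (blochData hA hα hβ h hone).IsBranch lam φ) (hM : IsEquivalentTo ω A M)
    (k l : Fin N) :
    (1 / 2 : ℝ) * iteratedFDeriv ℝ 2 lam 0 ![stdVec k, stdVec l] = M k l := by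
  refine hφ.half_iteratedFDeriv norm_sq_oneLp (fun i j => ?_) k l
  obtain ⟨w, G, h1, h2, h3⟩ := hM.2 (stdVec i)
  exact (IsCellPair.fderiv_vec hA hα hβ h hone hopen hbdd hnull hφ (IsCellPair.mk h1 h2 h3)).2 j

end Ground

theorem exists_bloch_ground_state {N : ℕ} {ω : Set (Euc N)} {α β : ℝ}
    {A : Euc N → Matrix (Fin N) (Fin N) ℝ} {M : Matrix (Fin N) (Fin N) ℝ}
    [IsFiniteMeasure (volume.restrict ω)] [CompleteSpace (H1c ω)]
    (hA : IsCoefficient α β ω A) (hα : 0 < α) (hβ : 0 ≤ β) {b : H1c ω →L[ℂ] ℂ} {C : ℝ}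
    (h : IsTraceWith b C) (hone : oneLp ω ≠ 0) (hopen : IsOpen ω) (hbdd : Bornology.IsBounded ω)
    (hnull : volume (frontier ω) = 0) (hM : IsEquivalentTo ω A M) :
    ∃ (U : Set (Euc N)) (φ : Euc N → H1c ω),
      IsOpen U ∧ (0 : Euc N) ∈ U ∧
      (∀ η ∈ U,
        IsLeast (blochEigenvalues ω A η) (groundEnergy ω A η) ∧
        IsBlochEigenpair A η (groundEnergy ω A η : ℂ) (φ η) ∧
        HasBoundaryValue (φ η : GraphSpace ω) (normConst ω : ℂ) ∧
        ∀ ψ : H1c ω,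
          IsBlochEigenpair A η (groundEnergy ω A η : ℂ) ψ →
            ∃ c : ℂ, ψ = c • φ η) ∧
      AnalyticOnNhd ℝ (groundEnergy ω A) U ∧
      AnalyticOnNhd ℝ φ U ∧
      (∀ᵐ y ∂volume.restrict ω, h1Val (φ 0) y = (normConst ω : ℂ)) ∧
      groundEnergy ω A 0 = 0 ∧
      (∀ k : Fin N, fderiv ℝ (groundEnergy ω A) 0 (stdVec k) = 0) ∧
      (∀ (k : Fin N) (w : Euc N → ℝ),
        IsCellSolution ω A M (stdVec k) w →
          ∀ᵐ y ∂volume.restrict ω,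
            h1Val (fderiv ℝ φ 0 (stdVec k)) y =
              Complex.I * (normConst ω : ℂ) * ((w y - y k : ℝ) : ℂ)) ∧
      ∀ k l : Fin N,
        (1 / 2 : ℝ) * iteratedFDeriv ℝ 2 (groundEnergy ω A) 0
          ![stdVec k, stdVec l] = M k l := by
  obtain ⟨U, lam, φ, hUo, h0U, hbr, hlam, hφ, hg⟩ :=
    (blochData hA hα hβ h hone).exists_ground_branch
  have ha := normConst_ne_zero hone
  have hE : ∀ η ∈ U, groundEnergy ω A η = lam η := fun η hη =>
    groundEnergy_eq_of_isGround hA hα hβ h hone (hg η hη)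
  -- The infimum is identified with `lam` only on `U`; as `U` is open, equality of germs transfers
  -- analyticity and derivatives.
  have hEv : ∀ η ∈ U, lam =ᶠ[𝓝 η] groundEnergy ω A := fun η hη =>
    (eventually_of_mem (hUo.mem_nhds hη) hE).mono fun _ e => e.symm
  refine ⟨U, fun η => (normConst ω : ℂ) • φ η, hUo, h0U, fun η hη =>
    isGround_spec hA hα hβ h hone ha (hg η hη), fun η hη => (hlam η hη).congr (hEv η hη),
    fun η hη => analyticAt_const.fun_smul (hφ η hη), ?_, (hE 0 h0U).trans hbr.lam_zero, fun k => ?_,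
    fun k w hw => ?_, fun k l => ?_⟩
  · have e : φ 0 = oneH1c ω := hbr.vec_zero
    simp only [e]
    exact coeFn_smul_oneH1c _
  · rw [← (hEv 0 h0U).fderiv_eq, hbr.fderiv_lam]
    rfl
  · obtain ⟨G, h1, h2, h3⟩ := hw
    rw [fderiv_smul_vec (hφ 0 h0U)]
    filter_upwards [coeFn_smul_h1c (normConst ω : ℂ) (fderiv ℝ φ 0 (stdVec k)),
      (IsCellPair.fderiv_vec hA hα hβ h hone hopen hbdd hnull hbr
        (IsCellPair.mk h1 h2 h3)).1] with y e1 e2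
    rw [e1, e2]
    ring
  · rw [← ((hEv 0 h0U).iteratedFDeriv ℝ 2).eq_of_nhds]
    exact half_iteratedFDeriv_lam hA hα hβ h hone hopen hbdd hnull hbr hM k l

end HSBloch

theorem mainTheorem2 {N : ℕ} (α β : ℝ) (hα : 0 < α) (hαβ : α < β)
    (ω : Set (HSBloch.Euc N)) (hopen : IsOpen ω) (hbdd : Bornology.IsBounded ω)
    (hne : ω.Nonempty) (hlip : HSBloch.HasLipschitzBoundary ω)
    (A : HSBloch.Euc N → Matrix (Fin N) (Fin N) ℝ) (hA : HSBloch.IsCoefficient α β ω A)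
    (M : Matrix (Fin N) (Fin N) ℝ) (hM : HSBloch.IsEquivalentTo ω A M) :
    ∃ (U : Set (HSBloch.Euc N)) (φ : HSBloch.Euc N → HSBloch.H1c ω),
      IsOpen U ∧ (0 : HSBloch.Euc N) ∈ U ∧
      (∀ η ∈ U,
        IsLeast (HSBloch.blochEigenvalues ω A η) (HSBloch.groundEnergy ω A η) ∧
        HSBloch.IsBlochEigenpair A η (HSBloch.groundEnergy ω A η : ℂ) (φ η) ∧
        HSBloch.HasBoundaryValue (φ η : HSBloch.GraphSpace ω) (HSBloch.normConst ω : ℂ) ∧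
        ∀ ψ : HSBloch.H1c ω,
          HSBloch.IsBlochEigenpair A η (HSBloch.groundEnergy ω A η : ℂ) ψ →
            ∃ c : ℂ, ψ = c • φ η) ∧
      AnalyticOnNhd ℝ (HSBloch.groundEnergy ω A) U ∧
      AnalyticOnNhd ℝ φ U ∧
      (∀ᵐ y ∂volume.restrict ω, HSBloch.h1Val (φ 0) y = (HSBloch.normConst ω : ℂ)) ∧
      HSBloch.groundEnergy ω A 0 = 0 ∧
      (∀ k : Fin N, fderiv ℝ (HSBloch.groundEnergy ω A) 0 (HSBloch.stdVec k) = 0) ∧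
      (∀ (k : Fin N) (w : HSBloch.Euc N → ℝ),
        HSBloch.IsCellSolution ω A M (HSBloch.stdVec k) w →
          ∀ᵐ y ∂volume.restrict ω,
            HSBloch.h1Val (fderiv ℝ φ 0 (HSBloch.stdVec k)) y =
              Complex.I * (HSBloch.normConst ω : ℂ) * ((w y - y k : ℝ) : ℂ)) ∧
      ∀ k l : Fin N,
        (1 / 2 : ℝ) * iteratedFDeriv ℝ 2 (HSBloch.groundEnergy ω A) 0
          ![HSBloch.stdVec k, HSBloch.stdVec l] = M k l := by
  have : IsFiniteMeasure (volume.restrict ω) :=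
    ⟨by rw [Measure.restrict_apply_univ]; exact hbdd.measure_lt_top⟩
  -- The Lipschitz condition enters only through the null frontier.
  have hnull := hlip.volume_frontier hopen
  have : CompleteSpace (HSBloch.H1c ω) :=
    (HSBloch.isClosed_h1c hopen hbdd hne hnull).completeSpace_coe
  obtain ⟨b, C, hb, hb'⟩ := HSBloch.exists_boundaryFunctional hopen hbdd hne hnull
  exact HSBloch.exists_bloch_ground_state hA hα (hα.trans hαβ).le
    ⟨fun p => (hb p).1, fun p => (hb p).2, hb'⟩ (HSBloch.oneLp_ne_zero hopen hbdd hne)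
    hopen hbdd hnull hM
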